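/- Let $d\ge 0$ be an integer and let $R\subset\mathbb{R}^d\setminus\{0\}$ be a root system, i.e. a finite set that is stable under the reflections $\sigma_\alpha(x)=x-2\langle x,\alpha\rangle\alpha/\|\alpha\|^2$, $\alpha\in R$. Let $G$ be the finite group generated by these reflections, fix $\beta\in\mathbb{R}^d$ with $\langle\alpha,\beta\rangle\neq 0$ for all $\alpha\in R$, and put $R_+=\{\alpha\in R:\langle\alpha,\beta\rangle>0\}$. Let $\mathcal P$ be the space of complex polynomial functions on $\mathbb{R}^d$ and $\mathcal P_n$ its subspace of homogeneous polynomials of degree $n$. For $g\in G$ write $(L_gp)(x)=p(gx)$. For a $G$-invariant function $k:R\to\mathbb{C}$ (a parameter function), the Dunkl operators on $\mathcal P$ are $$T_\xi p(x)=\partial_\xi p(x)+\sum_{\alpha\in R_+}k(\alpha)\langle\alpha,\xi\rangle\frac{p(x)-p(\sigma_\alpha x)}{\langle\alpha,x\rangle},\qquad \xi\in\mathbb{R}^d,$$ and for $n\ge1$ let $W_n=\bigl(n+\sum_{\alpha\in R_+}k(\alpha)\bigr)-\sum_{\alpha\in R_+}k(\alpha)L_{\sigma_\alpha}$ on $\mathcal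 P_n$. Let $M^*$ be the set of parameter functions $k$ for which $W_n$ is invertible on $\mathcal P_n$ for every $n\ge1$. The set $M^*$ contains every parameter function $k$ with $\operatorname{Re}k\ge0$. Let $k\in M^*$ and put $H_n=W_n^{-1}$ on $\mathcal P_n$, $n\ge 1$. There is a unique linear automorphism $V_k$ of $\mathcal P$ with $V_k(\mathcal P_n)\subset\mathcal P_n$ for all $n\ge0$, $V_k(1)=1$ and $T_\xi V_k=V_k\partial_\xi$ for all $\xi\in\mathbb{R}^d$ (the intertwining operator). Moreover there are functions $\lambda_n:G\to\mathbb{C}$ $(n\ge1)$ and a constant $\delta>0$ such that $$H_n=\sum_{g\in G}\lambda_n(g)L_g\ \text{ on }\mathcal P_n\quad\text{and}\quad |\lambda_n(g)|\le\frac{\delta}{n}\qquad(n\ge1,\ g\in G).\tag{1}$$ Let $E_n(x,y)=\frac1{n!}V_k(\langle\cdot,y\rangle^n)(x)$, let $e^{-\Delta/2}=\sum_{m\ge0}\frac{(-1/2)^m}{m!}\Delta^m$ (a finite sum on each polynomial), and let $d\gamma(y)=(2\pi)^{-d/2}e^{-\|y\|^2/2}\,dy$. Then there is a kernel $L_k:\mathbb{R}^d\times\mathbb{R}^d\to\mathbb{C}$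 with $L_k(x,\cdot)\in L^2(\mathbb{R}^d,d\gamma)$ for every $x$, such that, for all $p\in\mathcal P$ and $x\in\mathbb{R}^d$, the following integrand is integrable and $$V_k(p)(x)=\int_{\mathbb{R}^d}L_k(x,y)\,(e^{-\Delta/2}p)(y)\,d\gamma(y).$$ It is unique: if $L'$ is another kernel with $L'(x,\cdot)\in L^2(\mathbb{R}^d,d\gamma)$ for every $x$ and with this integral representation for all $p$ and $x$, then for every $x$ one has $L'(x,y)=L_k(x,y)$ for $\gamma$-almost every $y$. Moreover, for all $x,y\in\mathbb{R}^d$, $$L_k(x,y)=\sum_{n=0}^\infty\bigl(e^{-\Delta/2}E_n(x,\cdot)\bigr)(y)$$ (a convergent series), and for every choice of $(\lambda_n)_{n\ge1}$ and $\delta>0$ satisfying (1), $$|L_k(x,y)|\le e^{(\delta\sqrt d\,|G|\,\|x\|)^2/2}\;e^{\delta|G|\,\|x\|\,\|y\|}\qquad\text{for all }x,y\in\mathbb{R}^d.$$ -/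

import Mathlib

open scoped BigOperators InnerProductSpace

noncomputable section

namespace Dunkl

/-- The Euclidean space `ℝ^d`. -/
abbrev Space (d : ℕ) : Type := EuclideanSpace ℝ (Fin d)

/-- Polynomials in `d` variables with complex coefficients, i.e. complex polynomial functions
on `ℝ^d`. -/
abbrev Poly (d : ℕ) : Type := MvPolynomial (Fin d) ℂ

variable {d : ℕ}

/-- The polynomial function on `ℝ^d` attached to `p`. -/
def toFun (p : Poly d) (x : Space d) : ℂ :=
  MvPolynomial.eval (fun i => ((x i : ℝ) : ℂ)) p

/-- Homogeneous polynomials of degree `n` (with the zero polynomial). -/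
abbrev homog (d n : ℕ) : Submodule ℂ (Poly d) :=
  MvPolynomial.homogeneousSubmodule (Fin d) ℂ n

/-- The reflection `x ↦ x - 2 ⟨x, α⟩ α / ‖α‖²`. -/
def refl (α : Space d) : Space d ≃ₗᵢ[ℝ] Space d :=
  (ℝ ∙ α)ᗮ.reflection

theorem refl_apply (α x : Space d) :
    refl α x = x - (2 * ⟪x, α⟫_ℝ / ‖α‖ ^ 2) • α := by
  rw [refl, Submodule.reflection_orthogonal_apply, Submodule.reflection_singleton_apply,
    real_inner_comm]
  simp only [RCLike.ofReal_real_eq_id, id_eq]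
  rw [two_smul, ← add_smul, neg_sub]
  congr 2
  ring

/-- A (not necessarily reduced, crystallographic or spanning) root system in `ℝ^d`: a finite set
of nonzero vectors that is stable under the reflections in its elements. -/
structure IsRootSystem (R : Finset (Space d)) : Prop where
  zero_notMem : (0 : Space d) ∉ R
  refl_mem : ∀ α ∈ R, ∀ γ ∈ R, refl α γ ∈ R

/-- The group generated by the reflections in the elements of `R`. -/
def reflGroup (R : Finset (Space d)) : Subgroup (Space d ≃ₗᵢ[ℝ] Space d) :=
  Subgroup.closure (refl '' (R : Set (Space d)))

/-- The reflection group of a root system is finite. -/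
theorem IsRootSystem.finite_reflGroup {R : Finset (Space d)} (hR : IsRootSystem R) :
    Finite (reflGroup R) := by
  have hmem : ∀ g ∈ reflGroup R, ∀ γ ∈ R, g γ ∈ R := by
    intro g hg
    induction hg using Subgroup.closure_induction with
    | mem g hg =>
      obtain ⟨α, hα, rfl⟩ := hg
      exact hR.refl_mem α hα
    | one => intro γ hγ; exact hγ
    | mul a b _ _ ha hb => intro γ hγ; exact ha _ (hb γ hγ)
    | inv a _ ha =>
      intro γ hγ
      have hinj : Set.InjOn (fun v => a v) (R : Set (Space d)) := a.injective.injOn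
      have hsurj := Finset.surjOn_of_injOn_of_card_le (s := R) (t := R) (fun v => a v)
        (fun v hv => ha v hv) hinj le_rfl
      obtain ⟨v, hv, hva⟩ := hsurj hγ
      have : a⁻¹ γ = v := by
        rw [← hva]
        exact a.symm_apply_apply v
      rw [this]
      exact hv
  have hfix : ∀ g ∈ reflGroup R, ∀ x : Space d, (∀ α ∈ R, ⟪x, α⟫_ℝ = 0) → g x = x := by
    intro g hg
    induction hg using Subgroup.closure_induction with
    | mem g hg =>
      obtain ⟨α, hα, rfl⟩ := hg
      intro x hx
      rw [refl_apply, hx α hα]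
      simp
    | one => intro x _; rfl
    | mul a b _ _ ha hb =>
      intro x hx
      have : (a * b) x = a (b x) := rfl
      rw [this, hb x hx, ha x hx]
    | inv a _ ha =>
      intro x hx
      have : a⁻¹ (a x) = x := a.symm_apply_apply x
      rwa [ha x hx] at this
  let F : reflGroup R → (R → R) := fun g γ => ⟨g.1 γ.1, hmem g.1 g.2 γ.1 γ.2⟩
  refine Finite.of_injective F ?_
  intro g h hgh
  have hspan : ∀ v ∈ Submodule.span ℝ (R : Set (Space d)), g.1 v = h.1 v := by
    intro v hv
    induction hv using Submodule.span_induction with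
    | mem v hv =>
      have := congrFun hgh ⟨v, hv⟩
      exact congrArg Subtype.val this
    | zero => simp
    | add a b _ _ ha hb => simp [ha, hb]
    | smul c a _ ha => simp [ha]
  apply Subtype.ext
  apply LinearIsometryEquiv.ext
  intro x
  obtain ⟨y, hy, z, hz, rfl⟩ :=
    (Submodule.span ℝ (R : Set (Space d))).exists_add_mem_mem_orthogonal x
  have hz' : ∀ α ∈ R, ⟪z, α⟫_ℝ = 0 := by
    intro α hα
    exact (Submodule.mem_orthogonal' _ z).1 hz α (Submodule.subset_span hα)
  rw [map_add, map_add, hspan y hy, hfix _ g.2 z hz', hfix _ h.2 z hz']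

/-- The action `(L_g p)(x) = p (g x)` on polynomials. -/
def act (g : Space d ≃ₗᵢ[ℝ] Space d) : Poly d →ₐ[ℂ] Poly d :=
  MvPolynomial.aeval fun i => ∑ j : Fin d,
    MvPolynomial.C ((g (EuclideanSpace.single j 1) i : ℝ) : ℂ) * MvPolynomial.X j

theorem toFun_act (g : Space d ≃ₗᵢ[ℝ] Space d) (p : Poly d) (x : Space d) :
    toFun (act g p) x = toFun p (g x) := by
  have hx : g x = ∑ j : Fin d, x j • g (EuclideanSpace.single j 1) := by
    have : x = ∑ j : Fin d, x j • EuclideanSpace.single j (1 : ℝ) := by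
      ext i
      simp [Finset.sum_apply, Pi.single_apply]
    conv_lhs => rw [this]
    simp only [map_sum, map_smul]
  have key : (MvPolynomial.aeval (fun i => ((x i : ℝ) : ℂ))).comp (act g) =
      (MvPolynomial.aeval (fun i => ((g x i : ℝ) : ℂ)) : Poly d →ₐ[ℂ] ℂ) := by
    apply MvPolynomial.algHom_ext
    intro i
    simp only [act, AlgHom.comp_apply, MvPolynomial.aeval_X, map_sum, map_mul]
    rw [hx]
    simp [mul_comm]
  have := DFunLike.congr_fun key p
  simpa [toFun, MvPolynomial.aeval_eq_eval] using this

/-- The linear form `x ↦ ⟨x, α⟩` as a polynomial. -/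
def linForm (α : Space d) : Poly d :=
  ∑ i : Fin d, MvPolynomial.C ((α i : ℝ) : ℂ) * MvPolynomial.X i

theorem linForm_dvd (α : Space d) (p : Poly d) : linForm α ∣ p - act (refl α) p := by
  induction p using MvPolynomial.induction_on with
  | C a => simp [act]
  | add p q hp hq =>
    rw [map_add, add_sub_add_comm]
    exact dvd_add hp hq
  | mul_X p i hp =>
    have hX : linForm α ∣ MvPolynomial.X i - act (refl α) (MvPolynomial.X i) := by
      refine ⟨MvPolynomial.C (((2 / ‖α‖ ^ 2 * α i : ℝ)) : ℂ), ?_⟩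
      have h1 : (MvPolynomial.X i : Poly d) =
          ∑ j : Fin d, MvPolynomial.C (if i = j then 1 else 0) * MvPolynomial.X j := by
        simp [apply_ite]
      simp only [act, MvPolynomial.aeval_X]
      conv_lhs => rw [h1]
      rw [← Finset.sum_sub_distrib, linForm, Finset.sum_mul]
      refine Finset.sum_congr rfl fun j _ => ?_
      rw [← sub_mul, mul_right_comm, ← map_sub, ← map_mul]
      congr 2
      rw [refl_apply]
      by_cases hij : i = j
      · subst hij
        simp [EuclideanSpace.inner_single_left]
        ring
      · simp [EuclideanSpace.inner_single_left, hij]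
        ring
    have : p * MvPolynomial.X i - act (refl α) (p * MvPolynomial.X i) =
        (p - act (refl α) p) * MvPolynomial.X i +
          act (refl α) p * (MvPolynomial.X i - act (refl α) (MvPolynomial.X i)) := by
      rw [map_mul]; ring
    rw [this]
    exact dvd_add (dvd_mul_of_dvd_left hp _) (dvd_mul_of_dvd_right hX _)

/-- The polynomial `(p(x) - p(σ_α x)) / ⟨α, x⟩`. -/
def divDiff (α : Space d) (p : Poly d) : Poly d := (linForm_dvd α p).choose

theorem linForm_mul_divDiff (α : Space d) (p : Poly d) :
    linForm α * divDiff α p = p - act (refl α) p :=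
  (linForm_dvd α p).choose_spec.symm

open Classical in
/-- The positive roots `{α ∈ R : ⟨α, β⟩ > 0}`. -/
def posRoots (R : Finset (Space d)) (β : Space d) : Finset (Space d) :=
  R.filter fun α => 0 < ⟪α, β⟫_ℝ

/-- Parameter functions on `R`: invariant under the reflection group. Only the values on `R`
matter. -/
def IsParameter (R : Finset (Space d)) (k : Space d → ℂ) : Prop :=
  ∀ g ∈ reflGroup R, ∀ α ∈ R, k (g α) = k α

/-- The directional derivative `∂_ξ` on polynomials. -/
def dirDeriv (ξ : Space d) (p : Poly d) : Poly d :=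
  ∑ i : Fin d, ((ξ i : ℝ) : ℂ) • MvPolynomial.pderiv i p

/-- The Dunkl operator `T_ξ(k)` on polynomials. -/
def dunklOp (R : Finset (Space d)) (β : Space d) (k : Space d → ℂ) (ξ : Space d)
    (p : Poly d) : Poly d :=
  dirDeriv ξ p + ∑ α ∈ posRoots R β, (k α * ((⟪α, ξ⟫_ℝ : ℝ) : ℂ)) • divDiff α p

/-- `V` is an intertwining operator: a linear automorphism of the space of polynomials that
preserves homogeneity, fixes `1` and satisfies `T_ξ V = V ∂_ξ` for all `ξ`. -/
structure IsIntertwining (R : Finset (Space d)) (β : Space d) (k : Space d → ℂ)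
    (V : Poly d ≃ₗ[ℂ] Poly d) : Prop where
  map_homog : ∀ n : ℕ, ∀ p ∈ homog d n, V p ∈ homog d n
  map_one : V 1 = 1
  intertwines : ∀ (ξ : Space d) (p : Poly d), dunklOp R β k ξ (V p) = V (dirDeriv ξ p)

open Classical in
/-- The intertwining operator `V_k` (the identity if there is no intertwining operator). -/
def intertwiner (R : Finset (Space d)) (β : Space d) (k : Space d → ℂ) :
    Poly d ≃ₗ[ℂ] Poly d :=
  if h : ∃ V, IsIntertwining R β k V then h.choose else LinearEquiv.refl ℂ (Poly d)

/-- The sum of `k` over the positive roots. -/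
def sumParam (R : Finset (Space d)) (β : Space d) (k : Space d → ℂ) : ℂ :=
  ∑ α ∈ posRoots R β, k α

/-- `W_n = (n + ∑ k(α)) - ∑ k(α) L_{σ_α}`, sums over the positive roots. -/
def opW (R : Finset (Space d)) (β : Space d) (k : Space d → ℂ) (n : ℕ) (p : Poly d) : Poly d :=
  ((n : ℂ) + sumParam R β k) • p - ∑ α ∈ posRoots R β, k α • act (refl α) p

/-- The set `M*` of parameter functions for which `W_n` is invertible on the homogeneous
polynomials of degree `n`, for all `n ≥ 1`. -/
def MStar (R : Finset (Space d)) (β : Space d) : Set (Space d → ℂ) :=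
  {k | IsParameter R k ∧
    ∀ n : ℕ, 1 ≤ n → Set.BijOn (opW R β k n) (homog d n : Set (Poly d)) (homog d n)}

/-- `H_n`, the inverse of `W_n` on the homogeneous polynomials of degree `n`. -/
def opH (R : Finset (Space d)) (β : Space d) (k : Space d → ℂ) (n : ℕ) (p : Poly d) : Poly d :=
  Function.invFunOn (opW R β k n) (homog d n : Set (Poly d)) p

/-- The sequence `lam n : G → ℂ`, `n ≥ 1`, and the constant `δ > 0` satisfy
`H_n = ∑_{g ∈ G} lam n g • L_g` and `|lam n g| ≤ δ / n`. (The sum is over a finite group.) -/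
structure IsCoeffBound (R : Finset (Space d)) (β : Space d) (k : Space d → ℂ)
    (lam : ℕ → reflGroup R → ℂ) (δ : ℝ) : Prop where
  pos : 0 < δ
  opH_eq : ∀ n : ℕ, 1 ≤ n → ∀ p ∈ homog d n,
    opH R β k n p = ∑ᶠ g : reflGroup R, lam n g • act (g : Space d ≃ₗᵢ[ℝ] Space d) p
  bound : ∀ n : ℕ, 1 ≤ n → ∀ g : reflGroup R, ‖lam n g‖ ≤ δ / n

/-- `E_n(x, y) = V_k(⟨·, y⟩^n)(x) / n!`. -/
def homogKernel (R : Finset (Space d)) (β : Space d) (k : Space d → ℂ) (n : ℕ)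
    (x y : Space d) : ℂ :=
  (1 / (n.factorial : ℂ)) * toFun (intertwiner R β k (linForm y ^ n)) x

/-- `e^{-Δ/2} f = ∑_m (-1/2)^m / m! Δ^m f`. For a polynomial function `f` the sum is finite. -/
def expNegHalfLaplacian (f : Space d → ℂ) (y : Space d) : ℂ :=
  ∑' m : ℕ, ((-1 / 2 : ℂ) ^ m / (m.factorial : ℂ)) * (Laplacian.laplacian^[m] f) y

/-- The standard Gaussian measure `(2π)^{-d/2} e^{-‖z‖²/2} dz` on `ℝ^d`. -/
def gaussian (d : ℕ) : MeasureTheory.Measure (Space d) :=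
  MeasureTheory.volume.withDensity fun z =>
    ENNReal.ofReal (((2 * Real.pi) ^ ((d : ℝ) / 2))⁻¹ * Real.exp (-‖z‖ ^ 2 / 2))

end Dunkl

end

/-!
*Intertwining operator.* The commutator `[T_ξ, ⟨·, η⟩]` is a combination of the identity and
reflections, and `[[T_ξ, T_η], ⟨·, ζ⟩] = 0`; since `[T_ξ, T_η]` annihilates constants, Dunkl
operators commute (`dunklOp_comm`). So `q(T)` makes sense for a polynomial `q`, and
`(q(T) f)(0)` is a pairing of homogeneous polynomials of the same degree. The identity
`∑ x_i T_i = W_n` on polynomials of degree `n` (`sum_X_mul_dunklOp`) shows that for `k ∈ M*` only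
constants are annihilated by all `T_i`, hence that the pairing is nondegenerate. The operator `V` is characterized by
`(q(T) V p)(0) = (q(∂) p)(0)`; its existence is a matter of dimensions, and the relation
`T_ξ V = V ∂_ξ` follows by replacing `q` by `q x_i` (`exists_isIntertwining`). Uniqueness is the
recursion `W_n V p = ∑ x_i V (∂_i p)`. For `Re k ≥ 0` the operator `W_n` is injective since the
operators `1 - L_σ` are positive on `ℓ²` of each orbit.

*Coefficients.* For each `n` the inverse of `W_n` lies in the span of the `L_g`; for large `n` the
element of the group algebra that gives `W_n` is a small perturbation of `n`, so it is invertible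
with coefficients `O(1 / n)` (`exists_isCoeffBound`).

*Kernel.* The recursion becomes `E_n(x, y) = ∑ g, lam n g * ⟨g x, y⟩ * E_{n-1}(g x, y)`. Thus
`E_n(x, ·)` is a combination of products of `n` linear forms, and `e^{-Δ/2} E_n(x, ·)` can be
estimated by a univariate majorant on which `Δ` acts as the second derivative (`Majorized`). The
majorants sum up to `e^{c²/2} e^{c ‖y‖}` with `c = δ |G| ‖x‖`. Under `e^{-Δ/2}`, multiplication by
`⟨·, u⟩` becomes `⟨·, u⟩ - ∂_u`, the Gaussian adjoint of `∂_u`; therefore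
`∫ e^{-Δ/2}(⟨·, u⟩ p) e^{-Δ/2} q dγ = ∫ e^{-Δ/2} p e^{-Δ/2}(∂_u q) dγ`, and `E_n(x, ·)` represents
`p ↦ V p (x)` in degree `n` (`gaussPair_kernelPoly`), by the same recursion. Summing over `n` gives
the integral representation. The kernel is unique because `e^{-Δ/2}` is surjective on polynomials,
which are total in `L²(γ)` (`ae_eq_zero_of_integral_mul_toFun`).
-/

noncomputable section

namespace Dunkl

variable {d : ℕ}

/-! ### Polynomial functions, linear forms and the action of isometries -/

theorem toFun_injective {p q : Poly d} (h : ∀ x, toFun p x = toFun q x) : p = q := by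
  refine MvPolynomial.funext_set (fun _ => Set.range ((↑) : ℝ → ℂ))
    (fun _ => Set.infinite_range_of_injective Complex.ofReal_injective) fun z hz => ?_
  choose y hy using fun i => hz i (Set.mem_univ i)
  have := h (WithLp.toLp 2 y)
  simpa [toFun, hy] using this

@[simp] theorem toFun_add (p q : Poly d) (x : Space d) :
    toFun (p + q) x = toFun p x + toFun q x := map_add _ _ _

@[simp] theorem toFun_sub (p q : Poly d) (x : Space d) :
    toFun (p - q) x = toFun p x - toFun q x := map_sub _ _ _

@[simp] theorem toFun_mul (p q : Poly d) (x : Space d) :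
    toFun (p * q) x = toFun p x * toFun q x := map_mul _ _ _

@[simp] theorem toFun_pow (p : Poly d) (n : ℕ) (x : Space d) :
    toFun (p ^ n) x = toFun p x ^ n := map_pow _ _ _

@[simp] theorem toFun_smul (c : ℂ) (p : Poly d) (x : Space d) :
    toFun (c • p) x = c * toFun p x := by simp [toFun]

@[simp] theorem toFun_C (c : ℂ) (x : Space d) : toFun (MvPolynomial.C c) x = c := by simp [toFun]

@[simp] theorem toFun_X (i : Fin d) (x : Space d) : toFun (MvPolynomial.X i) x = x i := by
  simp [toFun]

@[simp] theorem toFun_zero (x : Space d) : toFun 0 x = 0 := by simp [toFun]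

@[simp] theorem toFun_one (x : Space d) : toFun 1 x = 1 := by simp [toFun]

@[simp] theorem toFun_sum {ι : Type*} (s : Finset ι) (f : ι → Poly d) (x : Space d) :
    toFun (∑ i ∈ s, f i) x = ∑ i ∈ s, toFun (f i) x := map_sum _ _ _

@[simp] theorem toFun_linForm (α x : Space d) : toFun (linForm α) x = (⟪x, α⟫_ℝ : ℝ) := by
  simp [linForm, PiLp.inner_apply]

theorem linForm_single (i : Fin d) :
    linForm (EuclideanSpace.single i (1 : ℝ)) = MvPolynomial.X i := by
  refine toFun_injective fun x => ?_
  simp [EuclideanSpace.inner_single_right]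

theorem linForm_neg (α : Space d) : linForm (-α) = -linForm α := by
  simp [linForm]

theorem linForm_ne_zero {α : Space d} (h : α ≠ 0) : linForm α ≠ 0 := by
  intro h0
  have := congrArg (fun p => toFun p α) h0
  simp [h] at this

theorem linForm_eq_sum (α : Space d) :
    linForm α = ∑ i, ((α i : ℝ) : ℂ) • (MvPolynomial.X i : Poly d) := by
  simp [linForm, MvPolynomial.smul_eq_C_mul]

theorem linForm_mem_homog (α : Space d) : linForm α ∈ homog d 1 :=
  Submodule.sum_mem _ fun i _ => MvPolynomial.isHomogeneous_C_mul_X _ i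

theorem linForm_mul_mem_homog (α : Space d) {n : ℕ} {p : Poly d} (hp : p ∈ homog d n) :
    linForm α * p ∈ homog d (n + 1) := by
  rw [add_comm]
  exact (linForm_mem_homog α).mul hp

/-- Polynomials are generated from constants by addition and multiplication by linear forms. -/
theorem poly_induction {P : Poly d → Prop} (p : Poly d) (hC : ∀ c, P (MvPolynomial.C c))
    (hadd : ∀ p q, P p → P q → P (p + q))
    (hmul : ∀ ξ p, P p → P (linForm ξ * p)) : P p := by
  induction p using MvPolynomial.induction_on with
  | C a => exact hC a
  | add p q hp hq => exact hadd p q hp hq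
  | mul_X p i hp =>
    rw [mul_comm, ← linForm_single]
    exact hmul _ _ hp

theorem act_act (g h : Space d ≃ₗᵢ[ℝ] Space d) (p : Poly d) :
    act g (act h p) = act (h * g) p :=
  toFun_injective fun x => by simp only [toFun_act]; rfl

theorem act_one (p : Poly d) : act 1 p = p :=
  toFun_injective fun x => by simp only [toFun_act]; rfl

theorem refl_refl (α x : Space d) : refl α (refl α x) = x :=
  Submodule.reflection_reflection _ x

theorem refl_mul_self (α : Space d) : refl α * refl α = 1 :=
  LinearIsometryEquiv.ext fun x => refl_refl α x

theorem refl_self (α : Space d) : refl α α = -α := by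
  have := Submodule.reflection_orthogonalComplement_singleton_eq_neg (𝕜 := ℝ) α
  exact this

theorem refl_neg (α : Space d) : refl (-α) = refl α := by
  refine LinearIsometryEquiv.ext fun x => ?_
  simp [refl_apply, neg_div, sub_eq_add_neg]

theorem refl_conj (g : Space d ≃ₗᵢ[ℝ] Space d) (α x : Space d) :
    refl (g α) (g x) = g (refl α x) := by
  simp [refl_apply]

theorem act_linForm (g : Space d ≃ₗᵢ[ℝ] Space d) (α : Space d) :
    act g (linForm (g α)) = linForm α :=
  toFun_injective fun x => by simp [toFun_act]

theorem act_mem_homog (g : Space d ≃ₗᵢ[ℝ] Space d) {n : ℕ} {p : Poly d} (hp : p ∈ homog d n) :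
    act g p ∈ homog d n := by
  have := MvPolynomial.IsHomogeneous.aeval (n := 1) hp (fun i => ∑ j : Fin d,
    MvPolynomial.C ((g (EuclideanSpace.single j 1) i : ℝ) : ℂ) * MvPolynomial.X j)
    (fun _ => Submodule.sum_mem (homog d 1) fun j _ => MvPolynomial.isHomogeneous_C_mul_X _ j)
  rw [one_mul] at this
  exact this

theorem act_smul (g : Space d ≃ₗᵢ[ℝ] Space d) (c : ℂ) (p : Poly d) :
    act g (c • p) = c • act g p := map_smul _ _ _

/-! ### Directional derivatives -/

theorem dirDeriv_add (ξ : Space d) (p q : Poly d) :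
    dirDeriv ξ (p + q) = dirDeriv ξ p + dirDeriv ξ q := by
  simp [dirDeriv, Finset.sum_add_distrib]

theorem dirDeriv_smul (ξ : Space d) (c : ℂ) (p : Poly d) :
    dirDeriv ξ (c • p) = c • dirDeriv ξ p := by
  simp only [dirDeriv, Finset.smul_sum]
  refine Finset.sum_congr rfl fun i _ => ?_
  rw [Derivation.map_smul, smul_comm]

theorem dirDeriv_mul (ξ : Space d) (p q : Poly d) :
    dirDeriv ξ (p * q) = dirDeriv ξ p * q + p * dirDeriv ξ q := by
  simp only [dirDeriv, Finset.sum_mul, Finset.mul_sum, ← Finset.sum_add_distrib]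
  refine Finset.sum_congr rfl fun i _ => ?_
  rw [MvPolynomial.pderiv_mul, smul_add, smul_mul_assoc, mul_smul_comm]

@[simp] theorem dirDeriv_C (ξ : Space d) (c : ℂ) : dirDeriv ξ (MvPolynomial.C c) = 0 := by
  simp [dirDeriv]

theorem dirDeriv_zero (ξ : Space d) : dirDeriv ξ (0 : Poly d) = 0 := by
  simp [dirDeriv]

theorem dirDeriv_single (i : Fin d) (p : Poly d) :
    dirDeriv (EuclideanSpace.single i (1 : ℝ)) p = MvPolynomial.pderiv i p := by
  classical
  rw [dirDeriv, Finset.sum_eq_single i]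
  · simp
  · intro j _ hj
    simp [hj]
  · simp

theorem dirDeriv_linForm (ξ η : Space d) :
    dirDeriv ξ (linForm η) = MvPolynomial.C ((⟪ξ, η⟫_ℝ : ℝ) : ℂ) := by
  classical
  have h (i : Fin d) : MvPolynomial.pderiv i (linForm η) = MvPolynomial.C ((η i : ℝ) : ℂ) := by
    simp [linForm, MvPolynomial.pderiv_X, Pi.single_apply]
  refine toFun_injective fun x => ?_
  simp only [dirDeriv, h, toFun_sum, toFun_smul, toFun_C, PiLp.inner_apply]
  simp [mul_comm]

theorem dirDeriv_linForm_mul (ξ η : Space d) (p : Poly d) :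
    dirDeriv ξ (linForm η * p) =
      linForm η * dirDeriv ξ p + ((⟪ξ, η⟫_ℝ : ℝ) : ℂ) • p := by
  rw [dirDeriv_mul, dirDeriv_linForm, MvPolynomial.smul_eq_C_mul, add_comm]

theorem dirDeriv_act (g : Space d ≃ₗᵢ[ℝ] Space d) (ξ : Space d) (p : Poly d) :
    dirDeriv ξ (act g p) = act g (dirDeriv (g ξ) p) := by
  induction p using poly_induction with
  | hC c => simp
  | hadd p q hp hq => simp [dirDeriv_add, hp, hq]
  | hmul η p hp =>
    obtain ⟨η, rfl⟩ := g.surjective η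
    rw [map_mul, act_linForm, dirDeriv_linForm_mul, dirDeriv_linForm_mul, map_add, map_mul,
      act_linForm, hp, act_smul, g.inner_map_map]

theorem dirDeriv_mem_homog (ξ : Space d) {n : ℕ} {p : Poly d} (hp : p ∈ homog d n) :
    dirDeriv ξ p ∈ homog d (n - 1) :=
  Submodule.sum_mem _ fun _ _ => Submodule.smul_mem _ _ (MvPolynomial.IsHomogeneous.pderiv hp)

/-- Euler's identity, in a form suited to induction on the degree. -/
theorem euler_identity {n : ℕ} {p : Poly d} (hp : p ∈ homog d n) :
    ∑ i, MvPolynomial.X i * MvPolynomial.pderiv i p = (n : ℂ) • p := by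
  have := MvPolynomial.IsHomogeneous.sum_X_mul_pderiv (R := ℂ) hp
  rw [this, Nat.cast_smul_eq_nsmul]

theorem homog_zero {p : Poly d} (hp : p ∈ homog d 0) : ∃ c, p = MvPolynomial.C c := by
  rw [homog, MvPolynomial.homogeneousSubmodule_zero] at hp
  obtain ⟨c, hc⟩ := Submodule.mem_one.1 hp
  exact ⟨c, hc.symm⟩

/-- A homogeneous polynomial of positive degree is a combination of products of variables with
homogeneous polynomials of lower degree. -/
theorem homog_induction {P : ℕ → Poly d → Prop} {n : ℕ} {p : Poly d} (hp : p ∈ homog d n)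
    (hC : ∀ c, P 0 (MvPolynomial.C c))
    (hadd : ∀ n p q, P n p → P n q → P n (p + q))
    (hsmul : ∀ n (c : ℂ) p, P n p → P n (c • p))
    (hmul : ∀ n i p, p ∈ homog d n → P n p → P (n + 1) (MvPolynomial.X i * p))
    (h0 : ∀ n, P n 0) :
    P n p := by
  induction n generalizing p with
  | zero =>
    obtain ⟨c, rfl⟩ := homog_zero hp
    exact hC c
  | succ n ih =>
    have he := euler_identity hp
    have hn : ((n + 1 : ℕ) : ℂ) ≠ 0 := Nat.cast_ne_zero.2 n.succ_ne_zero
    have : p = ((n + 1 : ℕ) : ℂ)⁻¹ • ∑ i, MvPolynomial.X i * MvPolynomial.pderiv i p := by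
      rw [he, inv_smul_smul₀ hn]
    rw [this]
    apply hsmul
    refine Finset.sum_induction _ (P (n + 1)) (fun a b => hadd _ a b) (h0 _) fun i _ => ?_
    have hi : MvPolynomial.pderiv i p ∈ homog d n := MvPolynomial.IsHomogeneous.pderiv hp
    exact hmul n _ _ hi (ih hi)

/-! ### Divided differences -/

theorem divDiff_eq_of_mul {α : Space d} (hα : α ≠ 0) {p q : Poly d}
    (h : linForm α * q = p - act (refl α) p) : divDiff α p = q :=
  mul_left_cancel₀ (linForm_ne_zero hα) ((linForm_mul_divDiff α p).trans h.symm)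

theorem divDiff_add {α : Space d} (hα : α ≠ 0) (p q : Poly d) :
    divDiff α (p + q) = divDiff α p + divDiff α q := by
  apply divDiff_eq_of_mul hα
  rw [mul_add, linForm_mul_divDiff, linForm_mul_divDiff, map_add]
  ring

theorem divDiff_smul {α : Space d} (hα : α ≠ 0) (c : ℂ) (p : Poly d) :
    divDiff α (c • p) = c • divDiff α p := by
  apply divDiff_eq_of_mul hα
  rw [mul_smul_comm, linForm_mul_divDiff, act_smul, smul_sub]

theorem divDiff_C {α : Space d} (hα : α ≠ 0) (c : ℂ) : divDiff α (MvPolynomial.C c) = 0 := by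
  apply divDiff_eq_of_mul hα
  simp

theorem divDiff_neg {α : Space d} (hα : α ≠ 0) (p : Poly d) :
    divDiff (-α) p = -divDiff α p := by
  apply divDiff_eq_of_mul (neg_ne_zero.2 hα)
  rw [linForm_neg, neg_mul_neg, linForm_mul_divDiff, refl_neg]

theorem linForm_sub_act_refl (α ξ : Space d) :
    linForm ξ - act (refl α) (linForm ξ) = ((2 * ⟪α, ξ⟫_ℝ / ‖α‖ ^ 2 : ℝ) : ℂ) • linForm α := by
  refine toFun_injective fun x => ?_
  simp only [toFun_sub, toFun_act, toFun_linForm, toFun_smul, refl_apply, inner_sub_left,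
    inner_smul_left]
  push_cast
  simp
  ring

theorem divDiff_linForm_mul {α : Space d} (hα : α ≠ 0) (ξ : Space d) (p : Poly d) :
    divDiff α (linForm ξ * p) =
      linForm ξ * divDiff α p + ((2 * ⟪α, ξ⟫_ℝ / ‖α‖ ^ 2 : ℝ) : ℂ) • act (refl α) p := by
  apply divDiff_eq_of_mul hα
  rw [mul_add, mul_left_comm, linForm_mul_divDiff, mul_smul_comm, ← smul_mul_assoc,
    ← linForm_sub_act_refl, map_mul]
  ring

theorem divDiff_act {α : Space d} (hα : α ≠ 0) (g : Space d ≃ₗᵢ[ℝ] Space d) (p : Poly d) :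
    divDiff α (act g p) = act g (divDiff (g α) p) := by
  apply divDiff_eq_of_mul hα
  rw [← act_linForm g, ← map_mul, linForm_mul_divDiff, map_sub]
  have h : act g (act (refl (g α)) p) = act (refl α) (act g p) :=
    toFun_injective fun x => by simp only [toFun_act, refl_conj]
  rw [h]

theorem divDiff_mem_homog {α : Space d} (hα : α ≠ 0) {n : ℕ} {p : Poly d} (hp : p ∈ homog d n) :
    divDiff α p ∈ homog d (n - 1) := by
  -- the second component keeps track of the vanishing in degree zero
  have key := homog_induction hp
    (P := fun n p => divDiff α p ∈ homog d (n - 1) ∧ (n = 0 → divDiff α p = 0))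
  refine (key ?_ ?_ ?_ ?_ ?_).1
  · intro c
    rw [divDiff_C hα]
    exact ⟨zero_mem _, fun _ => rfl⟩
  · intro n p q hp hq
    rw [divDiff_add hα]
    exact ⟨add_mem hp.1 hq.1, fun h => by rw [hp.2 h, hq.2 h, add_zero]⟩
  · intro n c p hp
    rw [divDiff_smul hα]
    exact ⟨Submodule.smul_mem _ _ hp.1, fun h => by rw [hp.2 h, smul_zero]⟩
  · intro n i p hpn hp
    refine ⟨?_, fun h => absurd h n.succ_ne_zero⟩
    rw [← linForm_single, divDiff_linForm_mul hα, Nat.add_sub_cancel]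
    refine add_mem ?_ (Submodule.smul_mem _ _ (act_mem_homog _ hpn))
    rcases n with _ | n
    · rw [hp.2 rfl, mul_zero]
      exact zero_mem _
    · exact linForm_mul_mem_homog _ hp.1
  · intro n
    have : divDiff α (0 : Poly d) = 0 := by simpa using divDiff_C hα 0
    rw [this]
    exact ⟨zero_mem _, fun _ => rfl⟩

/-! ### Sums over positive roots -/

section Roots

variable {R : Finset (Space d)} {β : Space d}

theorem mem_posRoots {α : Space d} : α ∈ posRoots R β ↔ α ∈ R ∧ 0 < ⟪α, β⟫_ℝ := by
  simp [posRoots]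

theorem mem_of_mem_posRoots {α : Space d} (h : α ∈ posRoots R β) : α ∈ R := (mem_posRoots.1 h).1

theorem IsRootSystem.ne_zero (hR : IsRootSystem R) {α : Space d} (h : α ∈ R) : α ≠ 0 :=
  fun h0 => hR.zero_notMem (h0 ▸ h)

theorem IsRootSystem.pos_ne_zero (hR : IsRootSystem R) {α : Space d} (h : α ∈ posRoots R β) :
    α ≠ 0 := hR.ne_zero (mem_of_mem_posRoots h)

theorem IsRootSystem.neg_mem (hR : IsRootSystem R) {α : Space d} (h : α ∈ R) : -α ∈ R := by
  have := hR.refl_mem α h α h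
  rwa [refl_self] at this

theorem refl_mem_reflGroup {α : Space d} (h : α ∈ R) : refl α ∈ reflGroup R :=
  Subgroup.subset_closure ⟨α, h, rfl⟩

theorem IsParameter.apply_neg {k : Space d → ℂ} (hk : IsParameter R k) {α : Space d} (h : α ∈ R) :
    k (-α) = k α := by
  have := hk _ (refl_mem_reflGroup h) α h
  rwa [refl_self] at this

theorem sum_roots_eq_two_nsmul {M : Type*} [AddCommMonoid M] (hR : IsRootSystem R)
    (hβ : ∀ α ∈ R, ⟪α, β⟫_ℝ ≠ 0) (F : Space d → M) (hF : ∀ α ∈ R, F (-α) = F α) :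
    ∑ α ∈ R, F α = 2 • ∑ α ∈ posRoots R β, F α := by
  classical
  rw [two_nsmul, ← Finset.sum_filter_add_sum_filter_not R (fun α => 0 < ⟪α, β⟫_ℝ)]
  congr 1
  refine Finset.sum_nbij' (fun α => -α) (fun α => -α) ?_ ?_ (by simp) (by simp) ?_
  · intro α hα
    rw [Finset.mem_filter, not_lt] at hα
    refine mem_posRoots.2 ⟨hR.neg_mem hα.1, ?_⟩
    rw [inner_neg_left]
    exact neg_pos.2 (lt_of_le_of_ne hα.2 (hβ α hα.1))
  · intro α hα
    rw [mem_posRoots] at hα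
    rw [Finset.mem_filter, not_lt, inner_neg_left]
    exact ⟨hR.neg_mem hα.1, neg_nonpos.2 hα.2.le⟩
  · intro α hα
    rw [hF α (Finset.mem_filter.1 hα).1]

/-- A sum of an even function over the positive roots does not change when the roots are
transformed by a reflection of the root system: it is half of the sum over all roots. -/
theorem sum_posRoots_refl {M : Type*} [AddCommGroup M] [Module ℂ M] (hR : IsRootSystem R)
    (hβ : ∀ α ∈ R, ⟪α, β⟫_ℝ ≠ 0) {γ : Space d} (hγ : γ ∈ R) (F : Space d → M)
    (hF : ∀ α ∈ R, F (-α) = F α) :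
    ∑ α ∈ posRoots R β, F (refl γ α) = ∑ α ∈ posRoots R β, F α := by
  have h1 := sum_roots_eq_two_nsmul hR hβ F hF
  have h2 := sum_roots_eq_two_nsmul hR hβ (fun α => F (refl γ α)) fun α hα => by
    simp only [map_neg]
    exact hF _ (hR.refl_mem γ hγ α hα)
  have h3 : ∑ α ∈ R, F (refl γ α) = ∑ α ∈ R, F α :=
    Finset.sum_nbij' (fun α => refl γ α) (fun α => refl γ α) (fun α hα => hR.refl_mem γ hγ α hα)
      (fun α hα => hR.refl_mem γ hγ α hα) (fun α _ => refl_refl γ α) (fun α _ => refl_refl γ α)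
      (fun _ _ => rfl)
  have h4 := h2.symm.trans (h3.trans h1)
  rw [← Nat.cast_smul_eq_nsmul ℂ, ← Nat.cast_smul_eq_nsmul ℂ] at h4
  exact smul_right_injective M (Nat.cast_ne_zero.2 two_ne_zero) h4

end Roots

/-! ### Dunkl operators -/

section DunklOperators

variable {R : Finset (Space d)} {β : Space d} {k : Space d → ℂ}

theorem dunklOp_add (hR : IsRootSystem R) (ξ : Space d) (p q : Poly d) :
    dunklOp R β k ξ (p + q) = dunklOp R β k ξ p + dunklOp R β k ξ q := by
  simp only [dunklOp, dirDeriv_add]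
  rw [add_add_add_comm, ← Finset.sum_add_distrib]
  congr 1
  refine Finset.sum_congr rfl fun α hα => ?_
  rw [divDiff_add (hR.pos_ne_zero hα), smul_add]

theorem dunklOp_smul (hR : IsRootSystem R) (ξ : Space d) (c : ℂ) (p : Poly d) :
    dunklOp R β k ξ (c • p) = c • dunklOp R β k ξ p := by
  simp only [dunklOp, dirDeriv_smul, smul_add, Finset.smul_sum]
  congr 1
  refine Finset.sum_congr rfl fun α hα => ?_
  rw [divDiff_smul (hR.pos_ne_zero hα), smul_comm]

/-- The Dunkl operator `T_ξ(k)` as a linear endomorphism of the space of polynomials. -/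
def dunklLin (hR : IsRootSystem R) (β : Space d) (k : Space d → ℂ) (ξ : Space d) :
    Module.End ℂ (Poly d) where
  toFun := dunklOp R β k ξ
  map_add' := dunklOp_add hR ξ
  map_smul' := dunklOp_smul hR ξ

@[simp] theorem dunklLin_apply (hR : IsRootSystem R) (ξ : Space d) (p : Poly d) :
    dunklLin hR β k ξ p = dunklOp R β k ξ p := rfl

theorem dunklOp_zero_param (ξ : Space d) (p : Poly d) : dunklOp R β 0 ξ p = dirDeriv ξ p := by
  simp [dunklOp]

theorem dunklOp_C (hR : IsRootSystem R) (ξ : Space d) (c : ℂ) :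
    dunklOp R β k ξ (MvPolynomial.C c) = 0 := by
  rw [dunklOp, dirDeriv_C, zero_add]
  refine Finset.sum_eq_zero fun α hα => ?_
  rw [divDiff_C (hR.pos_ne_zero hα), smul_zero]

theorem dunklOp_sub_smul_dir (ξ η : Space d) (c : ℝ) (p : Poly d) :
    dunklOp R β k (ξ - c • η) p = dunklOp R β k ξ p - (c : ℂ) • dunklOp R β k η p := by
  have h : dirDeriv (ξ - c • η) p = dirDeriv ξ p - (c : ℂ) • dirDeriv η p := by
    simp only [dirDeriv, Finset.smul_sum, ← Finset.sum_sub_distrib]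
    refine Finset.sum_congr rfl fun i _ => ?_
    rw [smul_smul, ← sub_smul]
    simp
  simp only [dunklOp, h, smul_add, Finset.smul_sum]
  rw [add_sub_add_comm, ← Finset.sum_sub_distrib]
  congr 1
  refine Finset.sum_congr rfl fun α _ => ?_
  rw [smul_smul, ← sub_smul, inner_sub_right, inner_smul_right]
  push_cast
  congr 1
  ring

theorem dunklOp_mem_homog (hR : IsRootSystem R) (ξ : Space d) {n : ℕ} {p : Poly d}
    (hp : p ∈ homog d n) : dunklOp R β k ξ p ∈ homog d (n - 1) :=
  add_mem (dirDeriv_mem_homog ξ hp) (Submodule.sum_mem _ fun _ hα =>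
    Submodule.smul_mem _ _ (divDiff_mem_homog (hR.pos_ne_zero hα) hp))

theorem dunklOp_act_refl (hR : IsRootSystem R) (hβ : ∀ α ∈ R, ⟪α, β⟫_ℝ ≠ 0)
    (hk : IsParameter R k) {γ : Space d} (hγ : γ ∈ R) (ξ : Space d) (p : Poly d) :
    dunklOp R β k ξ (act (refl γ) p) = act (refl γ) (dunklOp R β k (refl γ ξ) p) := by
  have h := sum_posRoots_refl hR hβ hγ
    (fun α => (k α * ((⟪α, refl γ ξ⟫_ℝ : ℝ) : ℂ)) • act (refl γ) (divDiff α p)) fun α hα => by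
      rw [hk.apply_neg hα, divDiff_neg (hR.ne_zero hα), inner_neg_left, map_neg]
      simp
  rw [dunklOp, dunklOp, map_add, dirDeriv_act, map_sum]
  simp only [act_smul]
  rw [← h]
  congr 1
  refine Finset.sum_congr rfl fun α hα => ?_
  rw [divDiff_act (hR.pos_ne_zero hα), hk _ (refl_mem_reflGroup hγ) α (mem_of_mem_posRoots hα),
    LinearIsometryEquiv.inner_map_map]

theorem dunklOp_linForm_mul (hR : IsRootSystem R) (ξ η : Space d) (p : Poly d) :
    dunklOp R β k ξ (linForm η * p) = linForm η * dunklOp R β k ξ p +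
      (((⟪ξ, η⟫_ℝ : ℝ) : ℂ) • p + ∑ α ∈ posRoots R β,
        (k α * ((2 * ⟪α, ξ⟫_ℝ * ⟪α, η⟫_ℝ / ‖α‖ ^ 2 : ℝ) : ℂ)) • act (refl α) p) := by
  rw [dunklOp, dunklOp, dirDeriv_linForm_mul, mul_add, Finset.mul_sum, add_add_add_comm,
    ← Finset.sum_add_distrib]
  congr 1
  refine Finset.sum_congr rfl fun α hα => ?_
  rw [divDiff_linForm_mul (hR.pos_ne_zero hα), smul_add, mul_smul_comm, smul_smul]
  congr 2
  push_cast
  ring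

/-- The second order commutation relation: up to terms that are symmetric in `ξ` and `η`, the
operator `T_ξ T_η` commutes with multiplication by a linear form. -/
theorem dunklOp_dunklOp_linForm_mul (hR : IsRootSystem R) (hβ : ∀ α ∈ R, ⟪α, β⟫_ℝ ≠ 0)
    (hk : IsParameter R k) (ξ η ζ : Space d) (p : Poly d) :
    dunklOp R β k ξ (dunklOp R β k η (linForm ζ * p)) =
      linForm ζ * dunklOp R β k ξ (dunklOp R β k η p) +
      ((((⟪ξ, ζ⟫_ℝ : ℝ) : ℂ) • dunklOp R β k η p + ((⟪η, ζ⟫_ℝ : ℝ) : ℂ) • dunklOp R β k ξ p) +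
      ∑ α ∈ posRoots R β,
        (k α * ((2 * ⟪α, ζ⟫_ℝ / ‖α‖ ^ 2 : ℝ) : ℂ)) •
          (((⟪α, ξ⟫_ℝ : ℝ) : ℂ) • act (refl α) (dunklOp R β k η p) +
            ((⟪α, η⟫_ℝ : ℝ) : ℂ) • act (refl α) (dunklOp R β k ξ p) -
            ((2 * ⟪α, ξ⟫_ℝ * ⟪α, η⟫_ℝ / ‖α‖ ^ 2 : ℝ) : ℂ) •
              act (refl α) (dunklOp R β k α p))) := by
  rw [dunklOp_linForm_mul hR η ζ]
  simp only [← dunklLin_apply hR, map_add, map_sum, map_smul]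
  simp only [dunklLin_apply, dunklOp_linForm_mul hR ξ ζ]
  have h : ∀ α ∈ posRoots R β, dunklOp R β k ξ (act (refl α) p) =
      act (refl α) (dunklOp R β k ξ p) -
        ((2 * ⟪ξ, α⟫_ℝ / ‖α‖ ^ 2 : ℝ) : ℂ) • act (refl α) (dunklOp R β k α p) := by
    intro α hα
    rw [dunklOp_act_refl hR hβ hk (mem_of_mem_posRoots hα), refl_apply, dunklOp_sub_smul_dir,
      map_sub, act_smul]
  have e : ∀ a b c s s' : Poly d, a + (b + s) + (c + s') = a + (b + c + (s + s')) := by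
    intros; ring
  rw [e, ← Finset.sum_add_distrib]
  refine congrArg₂ _ rfl (congrArg₂ _ rfl (Finset.sum_congr rfl fun α hα => ?_))
  rw [h α hα, real_inner_comm α ξ]
  push_cast
  module

/-- Dunkl operators commute: the commutator commutes with multiplication by linear forms and
annihilates constants. -/
theorem dunklOp_comm (hR : IsRootSystem R) (hβ : ∀ α ∈ R, ⟪α, β⟫_ℝ ≠ 0)
    (hk : IsParameter R k) (ξ η : Space d) (p : Poly d) :
    dunklOp R β k ξ (dunklOp R β k η p) = dunklOp R β k η (dunklOp R β k ξ p) := by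
  induction p using poly_induction with
  | hC c =>
    have h0 (ζ : Space d) : dunklOp R β k ζ 0 = 0 := (dunklLin hR β k ζ).map_zero
    rw [dunklOp_C hR, dunklOp_C hR, h0, h0]
  | hadd p q hp hq => simp only [dunklOp_add hR, hp, hq]
  | hmul ζ p hp =>
    rw [dunklOp_dunklOp_linForm_mul hR hβ hk, dunklOp_dunklOp_linForm_mul hR hβ hk, hp]
    rw [add_comm (((⟪ξ, ζ⟫_ℝ : ℝ) : ℂ) • _)]
    refine congrArg₂ _ rfl (congrArg₂ _ rfl (Finset.sum_congr rfl fun α _ => ?_))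
    rw [add_comm (((⟪α, ξ⟫_ℝ : ℝ) : ℂ) • _), mul_right_comm (2 : ℝ)]

theorem sum_X_mul_dunklOp {n : ℕ} {p : Poly d} (hp : p ∈ homog d n) :
    ∑ i, MvPolynomial.X i * dunklOp R β k (EuclideanSpace.single i (1 : ℝ)) p =
      opW R β k n p := by
  have h (α : Space d) : ∑ i, (k α * ((⟪α, EuclideanSpace.single i (1 : ℝ)⟫_ℝ : ℝ) : ℂ)) •
      ((MvPolynomial.X i : Poly d) * divDiff α p) = k α • (p - act (refl α) p) := by
    rw [← linForm_mul_divDiff, linForm_eq_sum, Finset.sum_mul, Finset.smul_sum]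
    refine Finset.sum_congr rfl fun i _ => ?_
    rw [smul_mul_assoc, smul_smul]
    simp [EuclideanSpace.inner_single_right]
  simp only [dunklOp, mul_add, Finset.mul_sum, mul_smul_comm, dirDeriv_single,
    Finset.sum_add_distrib]
  rw [Finset.sum_comm, euler_identity hp, Finset.sum_congr rfl fun α _ => h α, opW, sumParam]
  simp only [smul_sub, Finset.sum_sub_distrib, add_smul, Finset.sum_smul]
  abel

/-! ### The operators `W_n` -/

/-- The operator `W_n` as a linear endomorphism of the space of polynomials. -/
def opWLin (R : Finset (Space d)) (β : Space d) (k : Space d → ℂ) (n : ℕ) :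
    Module.End ℂ (Poly d) :=
  ((n : ℂ) + sumParam R β k) • LinearMap.id -
    ∑ α ∈ posRoots R β, k α • (act (refl α)).toLinearMap

@[simp] theorem opWLin_apply (n : ℕ) (p : Poly d) : opWLin R β k n p = opW R β k n p := by
  simp [opWLin, opW]

theorem opW_mem_homog {n : ℕ} {p : Poly d} (hp : p ∈ homog d n) : opW R β k n p ∈ homog d n :=
  sub_mem (Submodule.smul_mem _ _ hp) (Submodule.sum_mem _ fun _ _ =>
    Submodule.smul_mem _ _ (act_mem_homog _ hp))

instance finite_homog (n : ℕ) : Module.Finite ℂ (homog d n) :=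
  Module.Finite.iff_fg.2 (MvPolynomial.homogeneousSubmodule_fg (Fin d) ℂ n)

/-- The restriction of `W_n` to the homogeneous polynomials of degree `n`. -/
def opWHomog (R : Finset (Space d)) (β : Space d) (k : Space d → ℂ) (n : ℕ) :
    Module.End ℂ (homog d n) :=
  (opWLin R β k n).restrict fun p hp => by
    rw [opWLin_apply]
    exact opW_mem_homog hp

@[simp] theorem coe_opWHomog (n : ℕ) (p : homog d n) :
    (opWHomog R β k n p : Poly d) = opW R β k n p := by
  rw [← opWLin_apply]
  rfl

theorem bijOn_opW_of_injective {n : ℕ}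
    (h : ∀ p ∈ homog d n, opW R β k n p = 0 → p = 0) :
    Set.BijOn (opW R β k n) (homog d n : Set (Poly d)) (homog d n) := by
  have hinj : Function.Injective (opWHomog R β k n) := by
    rw [injective_iff_map_eq_zero]
    intro p hp
    refine Subtype.ext (h p p.2 ?_)
    rw [← coe_opWHomog, hp]
    rfl
  refine ⟨fun p hp => opW_mem_homog hp, fun p hp q hq hpq => ?_, fun q hq => ?_⟩
  · have : (⟨p, hp⟩ : homog d n) = ⟨q, hq⟩ := hinj (Subtype.ext (by simpa using hpq))
    exact congrArg Subtype.val this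
  · obtain ⟨p, hp⟩ := LinearMap.injective_iff_surjective.1 hinj ⟨q, hq⟩
    exact ⟨p, p.2, by simpa using congrArg Subtype.val hp⟩

theorem eq_zero_of_opW_eq_zero (hk : k ∈ MStar R β) {n : ℕ} (hn : 1 ≤ n) {p : Poly d}
    (hp : p ∈ homog d n) (h : opW R β k n p = 0) : p = 0 := by
  refine (hk.2 n hn).injOn hp (zero_mem _) ?_
  rw [h, ← opWLin_apply, map_zero]

/-- If `Re k ≥ 0` then `W_n` is injective for `n ≥ 1`. On each orbit the operators
`1 - L_σ` are positive for the `ℓ²` inner product, so that the real part of `⟨W_n p, p⟩` is at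
least `n ‖p‖²`. -/
theorem mem_MStar_of_re_nonneg (hR : IsRootSystem R) (hk : IsParameter R k)
    (hre : ∀ α ∈ R, 0 ≤ (k α).re) : k ∈ MStar R β := by
  refine ⟨hk, fun n hn => bijOn_opW_of_injective fun p _ hW => toFun_injective fun x => ?_⟩
  have := hR.finite_reflGroup
  have := Fintype.ofFinite (reflGroup R)
  set f : reflGroup R → ℂ := fun g => toFun p (g.1 x) with hf
  have hpt (g : reflGroup R) : (n : ℂ) * f g +
      ∑ α ∈ posRoots R β, k α * (f g - toFun p (refl α (g.1 x))) = 0 := by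
    have := congrArg (fun q => toFun q (g.1 x)) hW
    simp only [opW, sumParam, toFun_sub, toFun_smul, toFun_sum, toFun_act, toFun_zero] at this
    simp only [mul_sub, Finset.sum_sub_distrib, ← Finset.sum_mul]
    rw [← this]
    ring
  -- the quadratic form of `1 - L_σ` on an orbit
  have hpos : ∀ α ∈ posRoots R β, ∃ r : ℝ, 0 ≤ r ∧
      ∑ g, (starRingEnd ℂ) (f g) * (f g - toFun p (refl α (g.1 x))) = r := by
    intro α hα
    let s : reflGroup R := ⟨refl α, refl_mem_reflGroup (mem_of_mem_posRoots hα)⟩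
    have hs (g : reflGroup R) : toFun p (refl α (g.1 x)) = f (s * g) := rfl
    have hss : s * s = 1 := Subtype.ext (refl_mul_self α)
    simp only [hs]
    refine ⟨(∑ g, Complex.normSq (f g - f (s * g))) / 2,
      div_nonneg (Finset.sum_nonneg fun _ _ => Complex.normSq_nonneg _) two_pos.le, ?_⟩
    have h1 : ∑ g, (starRingEnd ℂ) (f g) * (f g - f (s * g)) =
        ∑ g, (starRingEnd ℂ) (f (s * g)) * (f (s * g) - f g) := by
      rw [← Equiv.sum_comp (Equiv.mulLeft s)]
      refine Finset.sum_congr rfl fun g _ => ?_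
      simp only [Equiv.coe_mulLeft, ← mul_assoc, hss, one_mul]
    have h2 : ∑ g, ((Complex.normSq (f g - f (s * g)) : ℝ) : ℂ) =
        2 * ∑ g, (starRingEnd ℂ) (f g) * (f g - f (s * g)) := by
      rw [two_mul]
      nth_rewrite 2 [h1]
      rw [← Finset.sum_add_distrib]
      refine Finset.sum_congr rfl fun g _ => ?_
      rw [Complex.normSq_eq_conj_mul_self, map_sub]
      ring
    push_cast
    rw [h2]
    ring
  have hsum : (n : ℂ) * ∑ g, ((Complex.normSq (f g) : ℝ) : ℂ) + ∑ α ∈ posRoots R β, k α *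
      ∑ g, (starRingEnd ℂ) (f g) * (f g - toFun p (refl α (g.1 x))) = 0 := by
    simp only [Finset.mul_sum]
    rw [Finset.sum_comm, ← Finset.sum_add_distrib]
    refine Finset.sum_eq_zero fun g _ => ?_
    rw [← mul_zero ((starRingEnd ℂ) (f g)), ← hpt g, mul_add, Finset.mul_sum,
      Complex.normSq_eq_conj_mul_self]
    congr 1
    · ring
    · exact Finset.sum_congr rfl fun α _ => by ring
  have hre' := congrArg Complex.re hsum
  rw [Complex.add_re, Complex.re_sum, ← Complex.ofReal_sum, ← Complex.ofReal_natCast,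
    ← Complex.ofReal_mul, Complex.ofReal_re, Complex.zero_re] at hre'
  have hnn : 0 ≤ ∑ α ∈ posRoots R β,
      (k α * ∑ g, (starRingEnd ℂ) (f g) * (f g - toFun p (refl α (g.1 x)))).re := by
    refine Finset.sum_nonneg fun α hα => ?_
    obtain ⟨r, hr, he⟩ := hpos α hα
    rw [he, Complex.re_mul_ofReal]
    exact mul_nonneg (hre α (mem_of_mem_posRoots hα)) hr
  have hn0 : (0 : ℝ) < n := Nat.cast_pos.2 hn
  have hz : ∑ g, Complex.normSq (f g) = 0 := by
    have h0 : 0 ≤ ∑ g, Complex.normSq (f g) :=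
      Finset.sum_nonneg fun _ _ => Complex.normSq_nonneg _
    by_contra hne
    have := mul_pos hn0 (lt_of_le_of_ne h0 (Ne.symm hne))
    linarith
  rw [Finset.sum_eq_zero_iff_of_nonneg fun _ _ => Complex.normSq_nonneg _] at hz
  rw [toFun_zero]
  exact Complex.normSq_eq_zero.1 (hz 1 (Finset.mem_univ _))

end DunklOperators

/-! ### The Dunkl pairing and the intertwining operator -/

section Intertwiner

variable {R : Finset (Space d)} {β : Space d} {k : Space d → ℂ}

open scoped IsMulCommutative in
theorem exists_algHom_of_commute {ι A : Type*} [Ring A] [Algebra ℂ A] (f : ι → A)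
    (h : ∀ i j, f i * f j = f j * f i) :
    ∃ Φ : MvPolynomial ι ℂ →ₐ[ℂ] A, ∀ i, Φ (MvPolynomial.X i) = f i := by
  have hc : ∀ a ∈ Set.range f, ∀ b ∈ Set.range f, a * b = b * a := by
    rintro _ ⟨i, rfl⟩ _ ⟨j, rfl⟩
    exact h i j
  have := Algebra.isMulCommutative_adjoin ℂ hc
  exact ⟨(Algebra.adjoin ℂ (Set.range f)).val.comp (MvPolynomial.aeval fun i =>
    (⟨f i, Algebra.subset_adjoin ⟨i, rfl⟩⟩ : Algebra.adjoin ℂ (Set.range f))), fun i => by simp⟩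

/-- The operator `q(T)` obtained by substituting the Dunkl operators `T_{e_i}(k)` for the
variables of a polynomial `q`. -/
def polyOp (hR : IsRootSystem R) (hβ : ∀ α ∈ R, ⟪α, β⟫_ℝ ≠ 0) (hk : IsParameter R k) :
    Poly d →ₐ[ℂ] Module.End ℂ (Poly d) :=
  (exists_algHom_of_commute
    (fun i : Fin d => dunklLin hR β k (EuclideanSpace.single i (1 : ℝ)))
    fun _ _ => LinearMap.ext fun p => dunklOp_comm hR hβ hk _ _ p).choose

theorem polyOp_X (hR : IsRootSystem R) (hβ : ∀ α ∈ R, ⟪α, β⟫_ℝ ≠ 0) (hk : IsParameter R k)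
    (i : Fin d) : polyOp hR hβ hk (MvPolynomial.X i) =
      dunklLin hR β k (EuclideanSpace.single i (1 : ℝ)) :=
  (exists_algHom_of_commute
    (fun i : Fin d => dunklLin hR β k (EuclideanSpace.single i (1 : ℝ)))
    fun _ _ => LinearMap.ext fun p => dunklOp_comm hR hβ hk _ _ p).choose_spec i

theorem polyOp_mul_X (hR : IsRootSystem R) (hβ : ∀ α ∈ R, ⟪α, β⟫_ℝ ≠ 0) (hk : IsParameter R k)
    (q : Poly d) (i : Fin d) (f : Poly d) :
    polyOp hR hβ hk (q * MvPolynomial.X i) f =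
      polyOp hR hβ hk q (dunklOp R β k (EuclideanSpace.single i (1 : ℝ)) f) := by
  rw [map_mul, polyOp_X]
  rfl

/-- The pairing `(f, q) ↦ (q(T) f)(0)`. -/
def dunklPair (hR : IsRootSystem R) (hβ : ∀ α ∈ R, ⟪α, β⟫_ℝ ≠ 0) (hk : IsParameter R k)
    (f q : Poly d) : ℂ :=
  MvPolynomial.coeff 0 (polyOp hR hβ hk q f)

theorem dunklPair_mul_X (hR : IsRootSystem R) (hβ : ∀ α ∈ R, ⟪α, β⟫_ℝ ≠ 0)
    (hk : IsParameter R k) (f q : Poly d) (i : Fin d) :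
    dunklPair hR hβ hk f (q * MvPolynomial.X i) =
      dunklPair hR hβ hk (dunklOp R β k (EuclideanSpace.single i (1 : ℝ)) f) q := by
  rw [dunklPair, polyOp_mul_X, dunklPair]

/-- For `k` in `M*` the Dunkl pairing is nondegenerate in each degree: a polynomial annihilated
by all `T_i` is annihilated by `W_n = ∑ x_i T_i`. -/
theorem eq_zero_of_dunklPair_eq_zero (hR : IsRootSystem R) (hβ : ∀ α ∈ R, ⟪α, β⟫_ℝ ≠ 0)
    (hk : k ∈ MStar R β) {n : ℕ} {f : Poly d} (hf : f ∈ homog d n)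
    (h : ∀ q ∈ homog d n, dunklPair hR hβ hk.1 f q = 0) : f = 0 := by
  induction n generalizing f with
  | zero =>
    obtain ⟨c, rfl⟩ := homog_zero hf
    have := h 1 (MvPolynomial.isHomogeneous_one _ _)
    rw [dunklPair, map_one] at this
    simp only [Module.End.one_apply, MvPolynomial.coeff_C, if_true] at this
    rw [this, map_zero]
  | succ n ih =>
    refine eq_zero_of_opW_eq_zero hk n.succ_pos hf ?_
    rw [← sum_X_mul_dunklOp hf]
    refine Finset.sum_eq_zero fun i _ => ?_
    rw [ih (dunklOp_mem_homog hR _ hf) fun q hq => ?_, mul_zero]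
    rw [← dunklPair_mul_X]
    exact h _ (MvPolynomial.IsHomogeneous.mul hq (MvPolynomial.isHomogeneous_X _ i))

/-- The Dunkl pairing on the homogeneous polynomials of degree `n`, as a map to the dual. -/
def dunklDual (hR : IsRootSystem R) (hβ : ∀ α ∈ R, ⟪α, β⟫_ℝ ≠ 0) (hk : IsParameter R k) (n : ℕ) :
    homog d n →ₗ[ℂ] Module.Dual ℂ (homog d n) :=
  LinearMap.mk₂ ℂ (fun f q => dunklPair hR hβ hk f q)
    (fun f g q => by simp [dunklPair]) (fun c f q => by simp [dunklPair])
    (fun f q r => by simp [dunklPair]) (fun c f q => by simp [dunklPair])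

theorem dunklDual_surjective (hR : IsRootSystem R) (hβ : ∀ α ∈ R, ⟪α, β⟫_ℝ ≠ 0)
    (hk : k ∈ MStar R β) (n : ℕ) : Function.Surjective (dunklDual hR hβ hk.1 n) := by
  rw [← LinearMap.injective_iff_surjective_of_finrank_eq_finrank
    (Subspace.dual_finrank_eq (K := ℂ) (V := homog d n)).symm, injective_iff_map_eq_zero]
  intro f hf
  refine Subtype.ext (eq_zero_of_dunklPair_eq_zero hR hβ hk f.2 fun q hq => ?_)
  exact LinearMap.congr_fun hf ⟨q, hq⟩

/-- The map of degree zero that transports the Dunkl pairing for `k` to the one for `k'`. -/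
theorem exists_pairing_transport (hR : IsRootSystem R) (hβ : ∀ α ∈ R, ⟪α, β⟫_ℝ ≠ 0)
    {k k' : Space d → ℂ} (hk : IsParameter R k) (hk' : k' ∈ MStar R β) :
    ∃ V : Poly d →ₗ[ℂ] Poly d, ∀ n, ∀ p ∈ homog d n, V p ∈ homog d n ∧
      ∀ q ∈ homog d n, dunklPair hR hβ hk'.1 (V p) q = dunklPair hR hβ hk p q := by
  have h (s : Fin d →₀ ℕ) : ∃ f ∈ homog d s.degree, ∀ q ∈ homog d s.degree,
      dunklPair hR hβ hk'.1 f q = dunklPair hR hβ hk (MvPolynomial.monomial s 1) q := by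
    obtain ⟨f, hf⟩ := dunklDual_surjective hR hβ hk' s.degree (dunklDual hR hβ hk s.degree
      ⟨MvPolynomial.monomial s 1, MvPolynomial.isHomogeneous_monomial _ rfl⟩)
    exact ⟨f, f.2, fun q hq => LinearMap.congr_fun hf ⟨q, hq⟩⟩
  choose v hv hpair using h
  let V := (MvPolynomial.basisMonomials (Fin d) ℂ).constr ℂ v
  have hV (s : Fin d →₀ ℕ) : V (MvPolynomial.monomial s 1) = v s := by
    have := (MvPolynomial.basisMonomials (Fin d) ℂ).constr_basis ℂ v s
    simpa using this
  refine ⟨V, fun n p hp => ?_⟩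
  have hdeg : ∀ s ∈ p.support, s.degree = n := fun s hs => by
    by_contra hne
    exact MvPolynomial.mem_support_iff.1 hs (MvPolynomial.IsHomogeneous.coeff_eq_zero hp hne)
  have hsum : p = ∑ s ∈ p.support, p.coeff s • MvPolynomial.monomial s (1 : ℂ) := by
    conv_lhs => rw [p.as_sum]
    exact Finset.sum_congr rfl fun s _ => by rw [MvPolynomial.smul_monomial, smul_eq_mul, mul_one]
  have hVp : V p = ∑ s ∈ p.support, p.coeff s • v s := by
    conv_lhs => rw [hsum]
    simp only [map_sum, map_smul, hV]
  refine ⟨?_, fun q hq => ?_⟩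
  · rw [hVp]
    refine Submodule.sum_mem _ fun s hs => Submodule.smul_mem _ _ ?_
    rw [← hdeg s hs]
    exact hv s
  · rw [hVp]
    conv_rhs => rw [hsum]
    simp only [dunklPair, map_sum, map_smul, MvPolynomial.coeff_sum, MvPolynomial.coeff_smul]
    refine Finset.sum_congr rfl fun s hs => ?_
    rw [← hdeg s hs] at hq
    exact congrArg _ (hpair s q hq)

theorem IsIntertwining.dunklOp_sum_X {V : Poly d ≃ₗ[ℂ] Poly d} (hV : IsIntertwining R β k V)
    {n : ℕ} {p : Poly d} (hp : p ∈ homog d n) :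
    opW R β k n (V p) = ∑ i, MvPolynomial.X i * V (MvPolynomial.pderiv i p) := by
  rw [← sum_X_mul_dunklOp (hV.map_homog n p hp)]
  refine Finset.sum_congr rfl fun i _ => ?_
  rw [hV.intertwines, dirDeriv_single]

theorem ext_homog {M : Type*} [AddCommMonoid M] [Module ℂ M] {f g : Poly d →ₗ[ℂ] M}
    (h : ∀ n, ∀ p ∈ homog d n, f p = g p) : f = g := by
  refine (MvPolynomial.basisMonomials (Fin d) ℂ).ext fun s => ?_
  rw [MvPolynomial.coe_basisMonomials]
  exact h s.degree _ (MvPolynomial.isHomogeneous_monomial _ rfl)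

theorem IsIntertwining.map_C {V : Poly d ≃ₗ[ℂ] Poly d} (hV : IsIntertwining R β k V) (c : ℂ) :
    V (MvPolynomial.C c) = MvPolynomial.C c := by
  have : (MvPolynomial.C c : Poly d) = c • 1 := by simp [MvPolynomial.smul_eq_C_mul]
  rw [this, map_smul, hV.map_one]

theorem IsIntertwining.unique (hk : k ∈ MStar R β) {V V' : Poly d ≃ₗ[ℂ] Poly d}
    (hV : IsIntertwining R β k V) (hV' : IsIntertwining R β k V') : V = V' := by
  have : V.toLinearMap = V'.toLinearMap := by
    refine ext_homog fun n p hp => ?_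
    change V p = V' p
    induction n generalizing p with
    | zero =>
      obtain ⟨c, rfl⟩ := homog_zero hp
      rw [hV.map_C, hV'.map_C]
    | succ n ih =>
      refine (hk.2 (n + 1) n.succ_pos).injOn (hV.map_homog _ p hp) (hV'.map_homog _ p hp) ?_
      rw [hV.dunklOp_sum_X hp, hV'.dunklOp_sum_X hp]
      refine Finset.sum_congr rfl fun i _ => ?_
      rw [ih _ (MvPolynomial.IsHomogeneous.pderiv hp)]
  exact LinearEquiv.toLinearMap_injective this

theorem zero_mem_MStar (hR : IsRootSystem R) : (0 : Space d → ℂ) ∈ MStar R β :=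
  mem_MStar_of_re_nonneg hR (fun _ _ _ _ => rfl) fun _ _ => le_rfl

theorem exists_isIntertwining (hR : IsRootSystem R) (hβ : ∀ α ∈ R, ⟪α, β⟫_ℝ ≠ 0)
    (hk : k ∈ MStar R β) : ∃ V, IsIntertwining R β k V := by
  have h0 : (0 : Space d → ℂ) ∈ MStar R β := zero_mem_MStar hR
  obtain ⟨V, hV⟩ := exists_pairing_transport hR hβ h0.1 hk
  obtain ⟨U, hU⟩ := exists_pairing_transport hR hβ hk.1 h0
  have ext {k : Space d → ℂ} (hk : k ∈ MStar R β) {n : ℕ} {f g : Poly d} (hf : f ∈ homog d n)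
      (hg : g ∈ homog d n)
      (h : ∀ q ∈ homog d n, dunklPair hR hβ hk.1 f q = dunklPair hR hβ hk.1 g q) : f = g := by
    rw [← sub_eq_zero]
    refine eq_zero_of_dunklPair_eq_zero hR hβ hk (sub_mem hf hg) fun q hq => ?_
    have := h q hq
    simp only [dunklPair, map_sub, MvPolynomial.coeff_sub] at this ⊢
    rw [this, sub_self]
  have hUV : U ∘ₗ V = LinearMap.id := ext_homog fun n p hp => by
    have h1 := hV n p hp
    have h2 := hU n _ h1.1
    exact ext h0 h2.1 hp fun q hq => (h2.2 q hq).trans (h1.2 q hq)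
  have hVU : V ∘ₗ U = LinearMap.id := ext_homog fun n p hp => by
    have h1 := hU n p hp
    have h2 := hV n _ h1.1
    exact ext hk h2.1 hp fun q hq => (h2.2 q hq).trans (h1.2 q hq)
  have hbasis (i : Fin d) (n : ℕ) (p : Poly d) (hp : p ∈ homog d n) :
      dunklOp R β k (EuclideanSpace.single i (1 : ℝ)) (V p) = V (MvPolynomial.pderiv i p) := by
    have hVp := hV n p hp
    rcases n with _ | n
    · obtain ⟨c, hc⟩ := homog_zero hVp.1
      obtain ⟨c', rfl⟩ := homog_zero hp
      rw [hc, dunklOp_C hR, MvPolynomial.pderiv_C, map_zero]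
    · have hd : MvPolynomial.pderiv i p ∈ homog d n := MvPolynomial.IsHomogeneous.pderiv hp
      have h2 := hV n _ hd
      refine ext hk (n := n) (dunklOp_mem_homog hR _ hVp.1) h2.1 fun q hq => ?_
      rw [← dunklPair_mul_X, hVp.2 _ (MvPolynomial.IsHomogeneous.mul hq
        (MvPolynomial.isHomogeneous_X _ i)), h2.2 q hq, dunklPair_mul_X, dunklOp_zero_param,
        dirDeriv_single]
  have hbasis' (i : Fin d) (p : Poly d) :
      dunklOp R β k (EuclideanSpace.single i (1 : ℝ)) (V p) = V (MvPolynomial.pderiv i p) := by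
    have : dunklLin hR β k (EuclideanSpace.single i (1 : ℝ)) ∘ₗ V =
        V ∘ₗ (MvPolynomial.pderiv i).toLinearMap := ext_homog (hbasis i)
    exact LinearMap.congr_fun this p
  refine ⟨LinearEquiv.ofLinearMap V U hVU hUV, fun n p hp => (hV n p hp).1, ?_, fun ξ p => ?_⟩
  · have h1 : (1 : Poly d) ∈ homog d 0 := MvPolynomial.isHomogeneous_one _ _
    refine ext hk (hV 0 1 h1).1 h1 fun q hq => ?_
    refine ((hV 0 1 h1).2 q hq).trans ?_
    obtain ⟨c, rfl⟩ := homog_zero hq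
    simp [dunklPair, ← MvPolynomial.algebraMap_eq]
  · change dunklOp R β k ξ (V p) = V (dirDeriv ξ p)
    have hξ : dunklOp R β k ξ (V p) =
        ∑ i, ((ξ i : ℝ) : ℂ) • dunklOp R β k (EuclideanSpace.single i (1 : ℝ)) (V p) := by
      simp only [dunklOp, smul_add, Finset.sum_add_distrib, dirDeriv_single, Finset.smul_sum]
      rw [Finset.sum_comm (s := Finset.univ)]
      refine congrArg₂ _ rfl (Finset.sum_congr rfl fun α _ => ?_)
      simp only [smul_smul, ← Finset.sum_smul]
      refine congrArg₂ _ ?_ rfl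
      simp [PiLp.inner_apply, Finset.mul_sum]
      refine Finset.sum_congr rfl fun i _ => by ring
    rw [hξ]
    simp only [hbasis', dirDeriv, map_sum, map_smul]

theorem isIntertwining_intertwiner (hR : IsRootSystem R) (hβ : ∀ α ∈ R, ⟪α, β⟫_ℝ ≠ 0)
    (hk : k ∈ MStar R β) : IsIntertwining R β k (intertwiner R β k) := by
  have h := exists_isIntertwining hR hβ hk
  rw [intertwiner, dif_pos h]
  exact h.choose_spec

end Intertwiner

/-! ### The inverse of `W_n` in the group algebra -/

section Coefficients

variable {R : Finset (Space d)} {β : Space d} {k : Space d → ℂ}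

open Classical in
/-- The reflection `σ_α` as an element of the reflection group, for `α ∈ R` (and `1` otherwise). -/
def reflElt (R : Finset (Space d)) (α : Space d) : reflGroup R :=
  if h : α ∈ R then ⟨refl α, refl_mem_reflGroup h⟩ else 1

theorem coe_reflElt {α : Space d} (h : α ∈ R) : (reflElt R α).1 = refl α := by
  simp [reflElt, h]

theorem reflElt_mul_self (α : Space d) : reflElt R α * reflElt R α = 1 := by
  by_cases h : α ∈ R
  · refine Subtype.ext ?_
    rw [Subgroup.coe_mul, coe_reflElt h, refl_mul_self]
    rfl
  · simp [reflElt, h]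

/-- The action of `W_n` on the coefficients of `∑ g, lam g • L_g`. -/
def coeffW (R : Finset (Space d)) (β : Space d) (k : Space d → ℂ) (n : ℕ) :
    (reflGroup R → ℂ) →ₗ[ℂ] (reflGroup R → ℂ) :=
  ((n : ℂ) + sumParam R β k) • LinearMap.id -
    ∑ α ∈ posRoots R β, k α • LinearMap.funLeft ℂ ℂ (fun g => g * reflElt R α)

theorem coeffW_apply (n : ℕ) (lam : reflGroup R → ℂ) (g : reflGroup R) :
    coeffW R β k n lam g = ((n : ℂ) + sumParam R β k) * lam g -
      ∑ α ∈ posRoots R β, k α * lam (g * reflElt R α) := by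
  simp [coeffW, LinearMap.sum_apply, Finset.sum_apply, LinearMap.funLeft_apply]

theorem opH_eq_of_opW_eq (hk : k ∈ MStar R β) {n : ℕ} (hn : 1 ≤ n) {p q : Poly d}
    (hp : p ∈ homog d n) (hq : opW R β k n p = q) : opH R β k n q = p := by
  rw [← hq]
  exact (hk.2 n hn).injOn.leftInvOn_invFunOn hp

theorem exists_mem_mul_eq_one {K V : Type*} [Field K] [AddCommGroup V] [Module K V]
    [FiniteDimensional K V] (W : Module.End K V) (hW : ∀ v, W v = 0 → v = 0)
    (S : Submodule K (Module.End K V)) (hmul : ∀ s ∈ S, W * s ∈ S) (h1 : 1 ∈ S) :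
    ∃ s ∈ S, W * s = 1 := by
  have hinj : Function.Injective ((LinearMap.mulLeft K W).restrict hmul) := by
    rw [injective_iff_map_eq_zero]
    intro s hs
    have hs' : W * s.1 = 0 := congrArg Subtype.val hs
    exact Subtype.ext (LinearMap.ext fun v => hW _ (LinearMap.congr_fun hs' v))
  obtain ⟨s, hs⟩ := LinearMap.injective_iff_surjective.1 hinj ⟨1, h1⟩
  exact ⟨s.1, s.2, congrArg Subtype.val hs⟩

variable [Fintype (reflGroup R)]

theorem opW_sum_act (n : ℕ) (lam : reflGroup R → ℂ) (p : Poly d) :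
    opW R β k n (∑ g, lam g • act g.1 p) = ∑ g, coeffW R β k n lam g • act g.1 p := by
  simp only [coeffW_apply, sub_smul, Finset.sum_sub_distrib, mul_smul, ← Finset.smul_sum]
  rw [opW]
  refine congrArg₂ _ rfl ?_
  simp only [Finset.sum_smul]
  rw [Finset.sum_comm]
  refine Finset.sum_congr rfl fun α hα => ?_
  rw [map_sum, Finset.smul_sum, ← Equiv.sum_comp (Equiv.mulRight (reflElt R α))]
  refine Finset.sum_congr rfl fun g _ => ?_
  rw [act_smul, act_act, smul_smul, ← coe_reflElt (mem_of_mem_posRoots hα), Equiv.coe_mulRight,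
    ← Subgroup.coe_mul, mul_assoc, reflElt_mul_self, mul_one]

/-- Left multiplication by `W_n` on the span of the operators `L_g` on homogeneous polynomials is
injective, hence surjective; so the inverse of `W_n` belongs to this span. -/
theorem exists_coeff (hk : k ∈ MStar R β) {n : ℕ} (hn : 1 ≤ n) :
    ∃ lam : reflGroup R → ℂ, ∀ p ∈ homog d n, opW R β k n (∑ g, lam g • act g.1 p) = p := by
  let L (g : reflGroup R) : Module.End ℂ (homog d n) :=
    (act g.1).toLinearMap.restrict fun p hp => act_mem_homog g.1 hp
  have hL (lam : reflGroup R → ℂ) (p : homog d n) :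
      ((Fintype.linearCombination ℂ L lam p : homog d n) : Poly d) =
        ∑ g, lam g • act g.1 (p : Poly d) := by
    rw [Fintype.linearCombination_apply, LinearMap.sum_apply, Submodule.coe_sum]
    rfl
  let S : Submodule ℂ (Module.End ℂ (homog d n)) :=
    LinearMap.range (Fintype.linearCombination ℂ L)
  have hmul : ∀ s ∈ S, opWHomog R β k n * s ∈ S := by
    rintro _ ⟨lam, rfl⟩
    refine ⟨coeffW R β k n lam, LinearMap.ext fun p => Subtype.ext ?_⟩
    rw [hL, Module.End.mul_apply, coe_opWHomog, hL, opW_sum_act]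
  have h1 : (1 : Module.End ℂ (homog d n)) ∈ S := by
    classical
    refine ⟨Pi.single 1 1, LinearMap.ext fun p => Subtype.ext ?_⟩
    rw [hL, Finset.sum_eq_single 1]
    · rw [Pi.single_eq_same, one_smul]
      exact act_one _
    · intro g _ hg
      rw [Pi.single_eq_of_ne hg, zero_smul]
    · simp
  obtain ⟨_, ⟨lam, rfl⟩, h2⟩ := exists_mem_mul_eq_one (opWHomog R β k n)
    (fun p hp => Subtype.ext (eq_zero_of_opW_eq_zero hk hn p.2 (by rw [← coe_opWHomog, hp]; rfl)))
    S hmul h1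
  refine ⟨lam, fun p hp => ?_⟩
  have h3 := congrArg Subtype.val (LinearMap.congr_fun h2 ⟨p, hp⟩)
  rw [Module.End.mul_apply, coe_opWHomog, hL] at h3
  exact h3

/-- For large `n` the operator `W_n` is a small perturbation of `n` in the group algebra, so the
coefficients of its inverse are `O(1 / n)`. -/
theorem exists_coeff_of_large {n : ℕ} (hn : 1 ≤ n) (hn' : 4 * ∑ α ∈ posRoots R β, ‖k α‖ ≤ n) :
    ∃ lam : reflGroup R → ℂ, (∀ p, opW R β k n (∑ g, lam g • act g.1 p) = p) ∧
      ∀ g, ‖lam g‖ ≤ 2 / n := by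
  classical
  set K := ∑ α ∈ posRoots R β, ‖k α‖ with hK
  have hn0 : (0 : ℝ) < n := Nat.cast_pos.2 hn
  -- in the sup norm, `W_n - n` has operator norm at most `2 K ≤ n / 2`
  have hbound (lam : reflGroup R → ℂ) : ‖lam‖ ≤ 2 / n * ‖coeffW R β k n lam‖ := by
    have h1 : n * ‖lam‖ ≤ ‖coeffW R β k n lam‖ + 2 * K * ‖lam‖ := by
      rw [mul_comm, ← le_div_iff₀ hn0]
      refine (pi_norm_le_iff_of_nonneg (div_nonneg (by positivity) hn0.le)).2 fun g => ?_
      rw [le_div_iff₀ hn0]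
      have h2 : lam g * n = coeffW R β k n lam g +
          (∑ α ∈ posRoots R β, k α * lam (g * reflElt R α) - sumParam R β k * lam g) := by
        rw [coeffW_apply]
        ring
      have h3 : ‖∑ α ∈ posRoots R β, k α * lam (g * reflElt R α)‖ ≤ K * ‖lam‖ := by
        rw [hK, Finset.sum_mul]
        refine norm_sum_le_of_le _ fun α _ => ?_
        rw [norm_mul]
        exact mul_le_mul_of_nonneg_left (norm_le_pi_norm lam _) (norm_nonneg _)
      have h4 : ‖sumParam R β k * lam g‖ ≤ K * ‖lam‖ := by
        rw [norm_mul]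
        exact mul_le_mul (norm_sum_le _ _) (norm_le_pi_norm lam g) (norm_nonneg _) (by positivity)
      calc ‖lam g‖ * n = ‖lam g * n‖ := by rw [norm_mul, Complex.norm_natCast]
        _ ≤ ‖coeffW R β k n lam g‖ + (K * ‖lam‖ + K * ‖lam‖) := by
          rw [h2]
          exact (norm_add_le _ _).trans
            (add_le_add_right ((norm_sub_le _ _).trans (add_le_add h3 h4)) _)
        _ ≤ ‖coeffW R β k n lam‖ + 2 * K * ‖lam‖ := by
          linarith [norm_le_pi_norm (coeffW R β k n lam) g]
    rw [div_mul_eq_mul_div, le_div_iff₀ hn0]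
    nlinarith [norm_nonneg lam]
  have hinj : Function.Injective (coeffW R β k n) := by
    rw [injective_iff_map_eq_zero]
    intro lam h
    have := hbound lam
    rw [h, norm_zero, mul_zero] at this
    exact norm_le_zero_iff.1 this
  obtain ⟨lam, hlam⟩ := LinearMap.injective_iff_surjective.1 hinj (Pi.single 1 1)
  refine ⟨lam, fun p => ?_, fun g => ?_⟩
  · rw [opW_sum_act, hlam, Finset.sum_eq_single 1]
    · rw [Pi.single_eq_same, one_smul]
      exact act_one _
    · intro g _ hg
      rw [Pi.single_eq_of_ne hg, zero_smul]
    · simp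
  · refine (norm_le_pi_norm lam g).trans ((hbound lam).trans ?_)
    rw [hlam]
    refine mul_le_of_le_one_right (by positivity) ?_
    refine (pi_norm_le_iff_of_nonneg zero_le_one).2 fun g => ?_
    rcases eq_or_ne g 1 with rfl | hg
    · simp
    · simp [hg]

end Coefficients

section CoeffBound

variable {R : Finset (Space d)} {β : Space d} {k : Space d → ℂ}

theorem exists_isCoeffBound (hR : IsRootSystem R) (hk : k ∈ MStar R β) :
    ∃ lam δ, IsCoeffBound R β k lam δ := by
  classical
  have := hR.finite_reflGroup
  have := Fintype.ofFinite (reflGroup R)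
  obtain ⟨N, hN⟩ := exists_nat_ge (4 * ∑ α ∈ posRoots R β, ‖k α‖)
  have h (n : ℕ) : ∃ lam : reflGroup R → ℂ, 1 ≤ n →
      (∀ p ∈ homog d n, opW R β k n (∑ g, lam g • act g.1 p) = p) ∧
      (N ≤ n → ∀ g, ‖lam g‖ ≤ 2 / n) := by
    by_cases hn : 1 ≤ n
    · by_cases hNn : N ≤ n
      · obtain ⟨lam, h1, h2⟩ := exists_coeff_of_large (R := R) (β := β) (k := k) hn
          (hN.trans (Nat.cast_le.2 hNn))
        exact ⟨lam, fun _ => ⟨fun p _ => h1 p, fun _ => h2⟩⟩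
      · obtain ⟨lam, h1⟩ := exists_coeff hk hn
        exact ⟨lam, fun _ => ⟨h1, fun h => absurd h hNn⟩⟩
    · exact ⟨0, fun h => absurd h hn⟩
  choose lam hlam using h
  have hnn : 0 ≤ ∑ n ∈ Finset.range N, ∑ g, n * ‖lam n g‖ := by positivity
  -- the sum takes care of the finitely many `n < N`
  refine ⟨lam, 2 + ∑ n ∈ Finset.range N, ∑ g, n * ‖lam n g‖, by linarith,
    fun n hn p hp => ?_, fun n hn g => ?_⟩
  · rw [finsum_eq_sum_of_fintype]
    refine opH_eq_of_opW_eq hk hn ?_ ((hlam n hn).1 p hp)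
    exact Submodule.sum_mem _ fun g _ => Submodule.smul_mem _ _ (act_mem_homog g.1 hp)
  · have hn0 : (0 : ℝ) < n := Nat.cast_pos.2 hn
    rw [le_div_iff₀ hn0]
    rcases le_or_gt N n with hNn | hNn
    · have := (hlam n hn).2 hNn g
      rw [le_div_iff₀ hn0] at this
      linarith
    · have h1 : n * ‖lam n g‖ ≤ ∑ g, n * ‖lam n g‖ :=
        Finset.single_le_sum (f := fun g => n * ‖lam n g‖) (fun _ _ => by positivity)
          (Finset.mem_univ g)
      have h2 : ∑ g, n * ‖lam n g‖ ≤ ∑ n ∈ Finset.range N, ∑ g, n * ‖lam n g‖ :=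
        Finset.single_le_sum (f := fun n : ℕ => ∑ g, n * ‖lam n g‖) (fun _ _ => by positivity)
          (Finset.mem_range.2 hNn)
      linarith

end CoeffBound

/-! ### The Laplacian on polynomials and the operator `e^{-Δ/2}` -/

section Heat

/-- The Laplacian on polynomials. -/
def polyLap : Module.End ℂ (Poly d) :=
  ∑ i, (MvPolynomial.pderiv i).toLinearMap * (MvPolynomial.pderiv i).toLinearMap

theorem polyLap_apply (p : Poly d) :
    polyLap p = ∑ i, MvPolynomial.pderiv i (MvPolynomial.pderiv i p) := by
  simp [polyLap]

@[simp] theorem polyLap_C (c : ℂ) : polyLap (MvPolynomial.C c : Poly d) = 0 := by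
  simp [polyLap_apply]

theorem polyLap_linForm_mul (u : Space d) (p : Poly d) :
    polyLap (linForm u * p) = linForm u * polyLap p + (2 : ℂ) • dirDeriv u p := by
  have h (i : Fin d) (q : Poly d) : MvPolynomial.pderiv i (linForm u * q) =
      linForm u * MvPolynomial.pderiv i q + ((u i : ℝ) : ℂ) • q := by
    rw [← dirDeriv_single, ← dirDeriv_single, dirDeriv_linForm_mul]
    simp [EuclideanSpace.inner_single_left]
  simp only [polyLap_apply, h, map_add, Derivation.map_smul, dirDeriv, Finset.mul_sum,
    Finset.smul_sum, ← Finset.sum_add_distrib]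
  refine Finset.sum_congr rfl fun i _ => ?_
  rw [add_assoc, two_smul]

theorem pderiv_comm (i j : Fin d) (p : Poly d) :
    MvPolynomial.pderiv i (MvPolynomial.pderiv j p) =
      MvPolynomial.pderiv j (MvPolynomial.pderiv i p) := by
  induction p using poly_induction with
  | hC c => simp
  | hadd p q hp hq => simp only [map_add, hp, hq]
  | hmul u p hp =>
    simp only [← dirDeriv_single, dirDeriv_linForm_mul, dirDeriv_add, dirDeriv_smul] at hp ⊢
    rw [hp, add_assoc, add_assoc, add_comm (_ • _) (_ • _)]

theorem polyLap_dirDeriv (u : Space d) (p : Poly d) :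
    polyLap (dirDeriv u p) = dirDeriv u (polyLap p) := by
  simp only [polyLap_apply, dirDeriv, map_sum, Derivation.map_smul]
  refine Finset.sum_congr rfl fun i _ => ?_
  rw [Finset.smul_sum]
  refine Finset.sum_congr rfl fun j _ => ?_
  rw [pderiv_comm j i, pderiv_comm j i]

theorem polyLap_pow_dirDeriv (u : Space d) (m : ℕ) (p : Poly d) :
    (polyLap ^ m) (dirDeriv u p) = dirDeriv u ((polyLap ^ m) p) := by
  induction m with
  | zero => rfl
  | succ m ih => rw [pow_succ', Module.End.mul_apply, ih, polyLap_dirDeriv, Module.End.mul_apply]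

theorem polyLap_pow_succ_linForm_mul (u : Space d) (m : ℕ) (p : Poly d) :
    (polyLap ^ (m + 1)) (linForm u * p) = linForm u * (polyLap ^ (m + 1)) p +
      (2 * ((m : ℂ) + 1)) • dirDeriv u ((polyLap ^ m) p) := by
  induction m with
  | zero => simp [polyLap_linForm_mul]
  | succ m ih =>
    rw [pow_succ', Module.End.mul_apply, ih, map_add, polyLap_linForm_mul, map_smul,
      polyLap_dirDeriv, ← Module.End.mul_apply polyLap, ← Module.End.mul_apply polyLap,
      ← pow_succ', ← pow_succ', add_assoc, ← add_smul]
    push_cast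
    refine congrArg₂ _ rfl (congrArg₂ _ ?_ rfl)
    ring

theorem exists_polyLap_pow_eq_zero (p : Poly d) : ∃ N, ∀ m, N ≤ m → (polyLap ^ m) p = 0 := by
  have hle {N m : ℕ} {p : Poly d} (h : (polyLap ^ N) p = 0) (hm : N ≤ m) :
      (polyLap ^ m) p = 0 := by
    rw [← Nat.sub_add_cancel hm, pow_add, Module.End.mul_apply, h, map_zero]
  suffices h : ∃ N, (polyLap ^ N) p = 0 from h.imp fun N hN m hm => hle hN hm
  induction p using poly_induction with
  | hC c => exact ⟨1, by simp⟩
  | hadd p q hp hq =>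
    obtain ⟨M, hM⟩ := hp
    obtain ⟨N, hN⟩ := hq
    exact ⟨max M N, by rw [map_add, hle hM (le_max_left _ _), hle hN (le_max_right _ _), add_zero]⟩
  | hmul u p hp =>
    obtain ⟨N, hN⟩ := hp
    refine ⟨N + 1, ?_⟩
    rw [polyLap_pow_succ_linForm_mul, hN, hle hN N.le_succ, dirDeriv_zero, mul_zero, smul_zero,
      add_zero]

/-- The coefficients of the exponential series `e^{-t/2}`. -/
def heatCoeff (m : ℕ) : ℂ := (-1 / 2 : ℂ) ^ m / (m.factorial : ℂ)

theorem heatCoeff_succ (m : ℕ) : heatCoeff (m + 1) * (2 * ((m : ℂ) + 1)) = -heatCoeff m := by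
  have h1 : (m.factorial : ℂ) ≠ 0 := Nat.cast_ne_zero.2 m.factorial_ne_zero
  have h2 : (m : ℂ) + 1 ≠ 0 := Nat.cast_add_one_ne_zero m
  rw [heatCoeff, heatCoeff, Nat.factorial_succ, pow_succ]
  push_cast
  field_simp

/-- The operator `e^{-Δ/2}` on polynomials, as a `finsum`: its support is finite because `Δ` is
locally nilpotent. -/
def heat (p : Poly d) : Poly d := ∑ᶠ m, heatCoeff m • (polyLap ^ m) p

theorem heat_eq_sum {p : Poly d} {N : ℕ} (h : ∀ m, N ≤ m → (polyLap ^ m) p = 0) :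
    heat p = ∑ m ∈ Finset.range N, heatCoeff m • (polyLap ^ m) p := by
  refine finsum_eq_sum_of_support_subset _ fun m hm => ?_
  rw [Finset.coe_range, Set.mem_Iio]
  by_contra hN
  exact hm (by simp only [h m (not_lt.1 hN), smul_zero])

theorem heat_add (p q : Poly d) : heat (p + q) = heat p + heat q := by
  obtain ⟨M, hM⟩ := exists_polyLap_pow_eq_zero p
  obtain ⟨N, hN⟩ := exists_polyLap_pow_eq_zero q
  have h1 : ∀ m, max M N ≤ m → (polyLap ^ m) p = 0 := fun m h => hM m (le_of_max_le_left h)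
  have h2 : ∀ m, max M N ≤ m → (polyLap ^ m) q = 0 := fun m h => hN m (le_of_max_le_right h)
  have h3 : ∀ m, max M N ≤ m → (polyLap ^ m) (p + q) = 0 := fun m h => by
    rw [map_add, h1 m h, h2 m h, add_zero]
  rw [heat_eq_sum h1, heat_eq_sum h2, heat_eq_sum h3, ← Finset.sum_add_distrib]
  exact Finset.sum_congr rfl fun m _ => by rw [map_add, smul_add]

theorem heat_smul (c : ℂ) (p : Poly d) : heat (c • p) = c • heat p := by
  obtain ⟨N, hN⟩ := exists_polyLap_pow_eq_zero p
  rw [heat_eq_sum hN, heat_eq_sum fun m h => by rw [map_smul, hN m h, smul_zero],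
    Finset.smul_sum]
  exact Finset.sum_congr rfl fun m _ => by rw [map_smul, smul_comm]

/-- `e^{-Δ/2}` as a linear map. -/
def heatLin : Poly d →ₗ[ℂ] Poly d where
  toFun := heat
  map_add' := heat_add
  map_smul' := heat_smul

@[simp] theorem heatLin_apply (p : Poly d) : heatLin p = heat p := rfl

theorem heat_C (c : ℂ) : heat (MvPolynomial.C c : Poly d) = MvPolynomial.C c := by
  rw [heat_eq_sum (N := 1)]
  · simp [heatCoeff]
  · intro m hm
    rw [← Nat.sub_add_cancel hm, pow_succ, Module.End.mul_apply, polyLap_C, map_zero]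

theorem heat_dirDeriv (u : Space d) (p : Poly d) :
    heat (dirDeriv u p) = dirDeriv u (heat p) := by
  obtain ⟨N, hN⟩ := exists_polyLap_pow_eq_zero p
  rw [heat_eq_sum hN, heat_eq_sum fun m h => by rw [polyLap_pow_dirDeriv, hN m h, dirDeriv_zero]]
  simp only [polyLap_pow_dirDeriv]
  simp only [dirDeriv, map_sum, Derivation.map_smul, Finset.smul_sum]
  rw [Finset.sum_comm]
  exact Finset.sum_congr rfl fun i _ => Finset.sum_congr rfl fun m _ => smul_comm _ _ _

/-- `e^{-Δ/2}` turns multiplication by the linear form of `u` into the creation operator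
`⟨·, u⟩ - ∂_u`. -/
theorem heat_linForm_mul (u : Space d) (p : Poly d) :
    heat (linForm u * p) = linForm u * heat p - dirDeriv u (heat p) := by
  obtain ⟨N, hN⟩ := exists_polyLap_pow_eq_zero p
  have h1 : ∀ m, N + 1 ≤ m → (polyLap ^ m) (linForm u * p) = 0 := fun m hm => by
    obtain ⟨m, rfl⟩ := Nat.exists_eq_add_of_le' (Nat.one_le_of_lt hm)
    rw [polyLap_pow_succ_linForm_mul, hN m (Nat.succ_le_succ_iff.1 hm),
      hN (m + 1) ((Nat.le_succ N).trans hm), dirDeriv_zero, mul_zero, smul_zero, add_zero]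
  have h2 : linForm u * heat p =
      ∑ m ∈ Finset.range (N + 1), heatCoeff m • (linForm u * (polyLap ^ m) p) := by
    rw [heat_eq_sum fun m hm => hN m ((Nat.le_succ N).trans hm), Finset.mul_sum]
    exact Finset.sum_congr rfl fun m _ => mul_smul_comm _ _ _
  have h3 : dirDeriv u (heat p) =
      ∑ m ∈ Finset.range N, heatCoeff m • dirDeriv u ((polyLap ^ m) p) := by
    rw [← heat_dirDeriv, heat_eq_sum fun m hm => by
      rw [polyLap_pow_dirDeriv, hN m hm, dirDeriv_zero]]
    simp only [polyLap_pow_dirDeriv]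
  rw [heat_eq_sum h1, h2, h3, Finset.sum_range_succ', Finset.sum_range_succ', add_sub_right_comm,
    ← Finset.sum_sub_distrib]
  refine congrArg₂ _ (Finset.sum_congr rfl fun m _ => ?_) rfl
  rw [polyLap_pow_succ_linForm_mul, smul_add, smul_smul, heatCoeff_succ, neg_smul, sub_eq_add_neg]

theorem heat_surjective : Function.Surjective (heat (d := d)) := by
  intro q
  induction q using poly_induction with
  | hC c => exact ⟨_, heat_C c⟩
  | hadd p q hp hq =>
    obtain ⟨a, rfl⟩ := hp
    obtain ⟨b, rfl⟩ := hq
    exact ⟨a + b, heat_add a b⟩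
  | hmul u q hq =>
    obtain ⟨a, rfl⟩ := hq
    refine ⟨linForm u * a + dirDeriv u a, ?_⟩
    rw [heat_add, heat_linForm_mul, heat_dirDeriv, sub_add_cancel]

theorem contDiff_toFun {n : WithTop ℕ∞} (p : Poly d) : ContDiff ℝ n (toFun p) := by
  induction p using poly_induction with
  | hC c =>
    have : toFun (MvPolynomial.C c : Poly d) = fun _ => c := funext fun x => toFun_C c x
    rw [this]
    exact contDiff_const
  | hadd p q hp hq =>
    rw [show toFun (p + q) = fun x => toFun p x + toFun q x from funext fun x => toFun_add p q x]
    exact hp.add hq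
  | hmul u p hp =>
    have h : ContDiff ℝ n fun x : Space d => ((⟪x, u⟫_ℝ : ℝ) : ℂ) :=
      Complex.ofRealCLM.contDiff.comp (contDiff_id.inner ℝ contDiff_const)
    rw [show toFun (linForm u * p) = fun x => ((⟪x, u⟫_ℝ : ℝ) : ℂ) * toFun p x from
      funext fun x => by rw [toFun_mul, toFun_linForm]]
    exact h.mul hp

theorem continuous_toFun (p : Poly d) : Continuous (toFun p) :=
  (contDiff_toFun (n := 0) p).continuous

theorem differentiable_toFun (p : Poly d) : Differentiable ℝ (toFun p) :=
  (contDiff_toFun (n := 1) p).differentiable one_ne_zero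

theorem fderiv_toFun (p : Poly d) (x v : Space d) :
    fderiv ℝ (toFun p) x v = toFun (dirDeriv v p) x := by
  induction p using poly_induction with
  | hC c =>
    have : toFun (MvPolynomial.C c : Poly d) = fun _ => c := funext fun x => toFun_C c x
    rw [this]
    simp
  | hadd p q hp hq =>
    have : toFun (p + q) = toFun p + toFun q := funext fun x => toFun_add p q x
    rw [this, fderiv_add (differentiable_toFun p x) (differentiable_toFun q x), dirDeriv_add,
      toFun_add, ← hp, ← hq]
    rfl
  | hmul u p hp =>
    have h1 : toFun (linForm u * p) = toFun (linForm u) * toFun p :=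
      funext fun x => toFun_mul _ p x
    have h2 : HasFDerivAt (toFun (linForm u)) (Complex.ofRealCLM.comp (innerSL ℝ u)) x := by
      have : toFun (linForm u) = Complex.ofRealCLM.comp (innerSL ℝ u) :=
        funext fun x => by simp [real_inner_comm]
      rw [this]
      exact ContinuousLinearMap.hasFDerivAt _
    rw [h1, fderiv_mul h2.differentiableAt (differentiable_toFun p x), h2.fderiv,
      dirDeriv_linForm_mul, toFun_add, toFun_mul, toFun_smul, ← hp]
    simp [real_inner_comm, mul_comm]

theorem laplacian_toFun (p : Poly d) : Laplacian.laplacian (toFun p) = toFun (polyLap p) := by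
  funext x
  rw [InnerProductSpace.laplacian_eq_iteratedFDeriv_orthonormalBasis _
    (EuclideanSpace.basisFun (Fin d) ℝ)]
  simp only [iteratedFDeriv_two_apply, polyLap_apply, toFun_sum]
  refine Finset.sum_congr rfl fun i _ => ?_
  simp only [EuclideanSpace.basisFun_apply, Matrix.cons_val_zero, Matrix.cons_val_one]
  have h : DifferentiableAt ℝ (fderiv ℝ (toFun p)) x :=
    ((contDiff_toFun (n := 2) p).fderiv_right (m := 1) (by norm_num)).differentiable
      one_ne_zero x
  have h2 : (fun x => fderiv ℝ (toFun p) x (EuclideanSpace.single i (1 : ℝ))) =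
      toFun (MvPolynomial.pderiv i p) := funext fun x => by rw [fderiv_toFun, dirDeriv_single]
  have h3 := fderiv_toFun (MvPolynomial.pderiv i p) x (EuclideanSpace.single i (1 : ℝ))
  rw [← h2, fderiv_clm_apply h (differentiableAt_const _), dirDeriv_single] at h3
  simpa using h3

theorem expNegHalfLaplacian_toFun (p : Poly d) :
    expNegHalfLaplacian (toFun p) = toFun (heat p) := by
  have h (m : ℕ) : Laplacian.laplacian^[m] (toFun p) = toFun ((polyLap ^ m) p) := by
    induction m with
    | zero => rfl
    | succ m ih => rw [Function.iterate_succ_apply', ih, laplacian_toFun, pow_succ']; rfl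
  obtain ⟨N, hN⟩ := exists_polyLap_pow_eq_zero p
  funext y
  rw [expNegHalfLaplacian, heat_eq_sum hN, toFun_sum, tsum_eq_sum (s := Finset.range N)]
  · exact Finset.sum_congr rfl fun m _ => by rw [h, toFun_smul, heatCoeff]
  · intro m hm
    rw [h, hN m (not_lt.1 fun hlt => hm (Finset.mem_range.2 hlt)), toFun_zero, mul_zero]

end Heat

/-! ### Majorants -/

section Majorant

/-- `Majorized F f`: the polynomial `f` is a combination of products of linear forms, and the
univariate real polynomial `F` is obtained by replacing each coefficient by a bound for its
absolute value and each form `⟨·, u⟩` by `b X` with `‖u‖ ≤ b`. -/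
inductive Majorized : Polynomial ℝ → Poly d → Prop
  | const {c : ℂ} {a : ℝ} (h : ‖c‖ ≤ a) : Majorized (Polynomial.C a) (MvPolynomial.C c)
  | linForm_mul {F : Polynomial ℝ} {f : Poly d} {u : Space d} {b : ℝ} (hf : Majorized F f)
      (h : ‖u‖ ≤ b) : Majorized (Polynomial.C b * (Polynomial.X * F)) (linForm u * f)
  | smul {F : Polynomial ℝ} {f : Poly d} {c : ℂ} {a : ℝ} (hf : Majorized F f) (h : ‖c‖ ≤ a) :
      Majorized (Polynomial.C a * F) (c • f)
  | add {F G : Polynomial ℝ} {f g : Poly d} (hf : Majorized F f) (hg : Majorized G g) :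
      Majorized (F + G) (f + g)

namespace Majorized

theorem zero : Majorized 0 (0 : Poly d) := by
  have := Majorized.const (d := d) (c := 0) (a := 0) (by simp)
  rwa [map_zero, map_zero] at this

theorem sum {ι : Type*} (s : Finset ι) {F : ι → Polynomial ℝ} {f : ι → Poly d}
    (h : ∀ i ∈ s, Majorized (F i) (f i)) : Majorized (∑ i ∈ s, F i) (∑ i ∈ s, f i) := by
  classical
  induction s using Finset.induction_on with
  | empty => simpa using zero
  | insert a s ha ih =>
    rw [Finset.sum_insert ha, Finset.sum_insert ha]
    exact (h a (Finset.mem_insert_self a s)).add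
      (ih fun i hi => h i (Finset.mem_insert_of_mem hi))

theorem norm_toFun_le {F : Polynomial ℝ} {f : Poly d} (h : Majorized F f) (y : Space d) :
    ‖toFun f y‖ ≤ F.eval ‖y‖ := by
  induction h with
  | const h => simpa using h
  | @linForm_mul F f u b hf h ih =>
    rw [toFun_mul, norm_mul, toFun_linForm, Complex.norm_real]
    have h1 : ‖⟪y, u⟫_ℝ‖ ≤ b * ‖y‖ := by
      refine (norm_inner_le_norm y u).trans ?_
      rw [mul_comm]
      exact mul_le_mul_of_nonneg_right h (norm_nonneg _)
    have h2 := mul_le_mul h1 ih (norm_nonneg _) ((norm_nonneg _).trans h1)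
    simpa [mul_assoc] using h2
  | smul hf h ih =>
    rw [toFun_smul, norm_mul]
    have := mul_le_mul h ih (norm_nonneg _) ((norm_nonneg _).trans h)
    simpa using this
  | add hf hg ihf ihg =>
    rw [toFun_add, Polynomial.eval_add]
    exact (norm_add_le _ _).trans (add_le_add ihf ihg)

theorem dirDeriv {F : Polynomial ℝ} {f : Poly d} (h : Majorized F f) {v : Space d} {b : ℝ}
    (hv : ‖v‖ ≤ b) : Majorized (Polynomial.C b * F.derivative) (Dunkl.dirDeriv v f) := by
  induction h with
  | const h => simpa using zero
  | @linForm_mul F f u b' hf h ih =>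
    rw [dirDeriv_linForm_mul]
    have h1 : ‖((⟪v, u⟫_ℝ : ℝ) : ℂ)‖ ≤ b * b' := by
      rw [Complex.norm_real]
      exact (norm_inner_le_norm v u).trans (mul_le_mul hv h (norm_nonneg _)
        ((norm_nonneg _).trans hv))
    convert (ih.linForm_mul h).add (hf.smul h1) using 1
    simp only [Polynomial.derivative_mul, Polynomial.derivative_C, Polynomial.derivative_X,
      map_mul]
    ring
  | smul hf h ih =>
    rw [dirDeriv_smul]
    convert ih.smul h using 1
    simp only [Polynomial.derivative_mul, Polynomial.derivative_C]
    ring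
  | add hf hg ihf ihg =>
    rw [dirDeriv_add, Polynomial.derivative_add, mul_add]
    exact ihf.add ihg

theorem polyLap {F : Polynomial ℝ} {f : Poly d} (h : Majorized F f) :
    Majorized F.derivative.derivative (Dunkl.polyLap f) := by
  induction h with
  | const h => simpa using zero
  | @linForm_mul F f u b hf h ih =>
    rw [polyLap_linForm_mul]
    convert (ih.linForm_mul h).add ((hf.dirDeriv h).smul (c := 2) (a := 2) (by simp)) using 1
    simp only [Polynomial.derivative_mul, Polynomial.derivative_C, Polynomial.derivative_X,
      Polynomial.derivative_add, map_ofNat, zero_mul, zero_add, one_mul]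
    ring
  | smul hf h ih =>
    rw [map_smul]
    convert ih.smul h using 1
    simp only [Polynomial.derivative_mul, Polynomial.derivative_C, zero_mul, zero_add]
  | add hf hg ihf ihg =>
    simp only [map_add]
    exact ihf.add ihg

theorem polyLap_pow {F : Polynomial ℝ} {f : Poly d} (h : Majorized F f) (m : ℕ) :
    Majorized (Polynomial.derivative^[2 * m] F) ((Dunkl.polyLap ^ m) f) := by
  induction m with
  | zero => exact h
  | succ m ih =>
    rw [pow_succ', Module.End.mul_apply, Nat.mul_succ, Nat.add_comm, Function.iterate_add_apply]
    exact ih.polyLap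

end Majorized

end Majorant

/-! ### The homogeneous components of the kernel -/

section Kernel

variable {R : Finset (Space d)} {β : Space d} {k : Space d → ℂ} [Fintype (reflGroup R)]

/-- The recursion for the intertwining operator that results from `V p = H_n (∑ x_i V (∂_i p))`
and the expansion of `H_n` in the operators `L_g`. -/
theorem IsIntertwining.toFun_succ {V : Poly d ≃ₗ[ℂ] Poly d} (hV : IsIntertwining R β k V)
    (hk : k ∈ MStar R β) {lam : ℕ → reflGroup R → ℂ} {δ : ℝ} (hlam : IsCoeffBound R β k lam δ)
    {n : ℕ} {p : Poly d} (hp : p ∈ homog d (n + 1)) (x : Space d) :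
    toFun (V p) x = ∑ g : reflGroup R, lam (n + 1) g * toFun (V (dirDeriv (g.1 x) p)) (g.1 x) := by
  have h1 := opH_eq_of_opW_eq hk n.succ_pos (hV.map_homog _ p hp) (hV.dunklOp_sum_X hp)
  have h2 : ∑ i, MvPolynomial.X i * V (MvPolynomial.pderiv i p) ∈ homog d (n + 1) := by
    rw [← hV.dunklOp_sum_X hp]
    exact opW_mem_homog (hV.map_homog _ p hp)
  rw [← h1, hlam.opH_eq _ n.succ_pos _ h2, finsum_eq_sum_of_fintype, toFun_sum]
  refine Finset.sum_congr rfl fun g _ => ?_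
  rw [toFun_smul, toFun_act]
  simp only [toFun_sum, toFun_mul, toFun_X, dirDeriv, map_sum, map_smul, toFun_smul]

/-- The polynomial `E_n(x, ·)` in the second variable, expressed through the coefficients of the
operators `H_n`. -/
def kernelPoly (lam : ℕ → reflGroup R → ℂ) : ℕ → Space d → Poly d
  | 0, _ => 1
  | n + 1, x => ∑ g : reflGroup R, lam (n + 1) g • (linForm (g.1 x) * kernelPoly lam n (g.1 x))

theorem dirDeriv_linForm_pow (ξ η : Space d) (n : ℕ) :
    dirDeriv ξ (linForm η ^ (n + 1)) =
      (((n : ℂ) + 1) * ((⟪ξ, η⟫_ℝ : ℝ) : ℂ)) • linForm η ^ n := by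
  induction n with
  | zero => rw [zero_add, pow_one, dirDeriv_linForm, pow_zero, MvPolynomial.smul_eq_C_mul]; simp
  | succ n ih =>
    rw [pow_succ', dirDeriv_linForm_mul, ih, mul_smul_comm, ← pow_succ', ← add_smul]
    push_cast
    refine congrArg₂ _ ?_ rfl
    ring

theorem homogKernel_eq_toFun (hR : IsRootSystem R) (hβ : ∀ α ∈ R, ⟪α, β⟫_ℝ ≠ 0)
    (hk : k ∈ MStar R β) {lam : ℕ → reflGroup R → ℂ} {δ : ℝ} (hlam : IsCoeffBound R β k lam δ)
    (n : ℕ) (x : Space d) : homogKernel R β k n x = toFun (kernelPoly lam n x) := by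
  have hV := isIntertwining_intertwiner hR hβ hk
  funext y
  induction n generalizing x with
  | zero => simp [homogKernel, kernelPoly, hV.map_one]
  | succ n ih =>
    have hy : linForm y ^ (n + 1) ∈ homog d (n + 1) := by
      have := MvPolynomial.IsHomogeneous.pow (linForm_mem_homog y) (n + 1)
      rwa [one_mul] at this
    have hn : (n : ℂ) + 1 ≠ 0 := Nat.cast_add_one_ne_zero n
    rw [homogKernel, hV.toFun_succ hk hlam hy, kernelPoly, toFun_sum, Finset.mul_sum]
    refine Finset.sum_congr rfl fun g _ => ?_
    rw [toFun_smul, toFun_mul, ← ih, homogKernel, dirDeriv_linForm_pow, map_smul, toFun_smul,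
      toFun_linForm, real_inner_comm, Nat.factorial_succ]
    push_cast
    field_simp

theorem majorized_kernelPoly {lam : ℕ → reflGroup R → ℂ} {δ : ℝ}
    (hlam : IsCoeffBound R β k lam δ) (n : ℕ) (x : Space d) :
    Majorized (Polynomial.C ((δ * Nat.card (reflGroup R) * ‖x‖) ^ n / n.factorial) *
      Polynomial.X ^ n) (kernelPoly lam n x) := by
  induction n generalizing x with
  | zero =>
    have := Majorized.const (d := d) (c := 1) (a := 1) (by simp)
    simpa [kernelPoly] using this
  | succ n ih =>
    rw [kernelPoly]
    have h := Majorized.sum Finset.univ fun (g : reflGroup R) _ =>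
      ((ih (g.1 x)).linForm_mul (g.1.norm_map x).le).smul (hlam.bound (n + 1) n.succ_pos g)
    convert h using 1
    simp only [LinearIsometryEquiv.norm_map]
    rw [Finset.sum_const, Finset.card_univ, ← Nat.card_eq_fintype_card, nsmul_eq_mul,
      ← Polynomial.C_eq_natCast, pow_succ' Polynomial.X n]
    have e : ∀ (a b c e f : ℝ) (X Y : Polynomial ℝ), f = a * b * c * e →
        Polynomial.C f * (X * Y) = Polynomial.C a * (Polynomial.C b * (Polynomial.C c *
          (X * (Polynomial.C e * Y)))) := by
      intro a b c e f X Y h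
      rw [h]
      simp only [map_mul]
      ring
    refine e _ _ _ _ _ _ _ ?_
    rw [Nat.factorial_succ]
    push_cast
    field_simp
    rw [pow_succ']

end Kernel

/-! ### Summation of the majorants -/

section Estimates

/-- The majorant of the `m`-th term of `e^{-Δ/2} E_n`, for `c = δ |G| ‖x‖` and `r = ‖y‖`. -/
def majorantTerm (c r : ℝ) (m n : ℕ) : ℝ :=
  (1 / 2) ^ m / m.factorial *
    (Polynomial.derivative^[2 * m]
      (Polynomial.C (c ^ n / n.factorial) * Polynomial.X ^ n)).eval r

theorem majorantTerm_eq (c r : ℝ) (m n : ℕ) : majorantTerm c r m n =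
    (1 / 2) ^ m / m.factorial *
      (c ^ n / n.factorial * (n.descFactorial (2 * m) * r ^ (n - 2 * m))) := by
  rw [majorantTerm, Polynomial.iterate_derivative_C_mul,
    Polynomial.iterate_derivative_X_pow_eq_smul]
  simp only [Polynomial.eval_mul, Polynomial.eval_C, Polynomial.eval_smul, Polynomial.eval_pow,
    Polynomial.eval_X, smul_eq_mul]

theorem majorantTerm_nonneg {c r : ℝ} (hc : 0 ≤ c) (hr : 0 ≤ r) (m n : ℕ) :
    0 ≤ majorantTerm c r m n := by
  rw [majorantTerm_eq]
  positivity

theorem hasSum_exp (x : ℝ) : HasSum (fun n : ℕ => x ^ n / n.factorial) (Real.exp x) := by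
  rw [Real.exp_eq_exp_ℝ]
  exact NormedSpace.expSeries_div_hasSum_exp x

theorem hasSum_majorantTerm_right (c r : ℝ) (m : ℕ) :
    HasSum (majorantTerm c r m) ((c ^ 2 / 2) ^ m / m.factorial * Real.exp (c * r)) := by
  rw [← hasSum_nat_add_iff' (2 * m), Finset.sum_eq_zero, sub_zero]
  · refine ((hasSum_exp (c * r)).mul_left ((c ^ 2 / 2) ^ m / m.factorial)).congr_fun ?_
    intro j
    rw [majorantTerm_eq, Nat.add_sub_cancel]
    have h1 : ((j.factorial : ℝ)) * ((j + 2 * m).descFactorial (2 * m) : ℝ) =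
        ((j + 2 * m).factorial : ℝ) := by
      have := Nat.factorial_mul_descFactorial (Nat.le_add_left (2 * m) j)
      rw [Nat.add_sub_cancel] at this
      exact_mod_cast this
    have h2 : (j.factorial : ℝ) ≠ 0 := Nat.cast_ne_zero.2 j.factorial_ne_zero
    have h3 : (m.factorial : ℝ) ≠ 0 := Nat.cast_ne_zero.2 m.factorial_ne_zero
    have h4 : ((j + 2 * m).descFactorial (2 * m) : ℝ) ≠ 0 := by
      intro h0
      rw [h0, mul_zero] at h1
      exact (j + 2 * m).factorial_ne_zero (Nat.cast_eq_zero.1 h1.symm)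
    rw [← h1]
    field_simp
    rw [div_pow, div_pow]
    field_simp
    ring
  · intro n hn
    rw [majorantTerm_eq, Nat.descFactorial_of_lt (Finset.mem_range.1 hn)]
    simp

theorem hasSum_majorantTerm {c r : ℝ} (hc : 0 ≤ c) (hr : 0 ≤ r) :
    HasSum (fun p : ℕ × ℕ => majorantTerm c r p.1 p.2)
      (Real.exp (c ^ 2 / 2) * Real.exp (c * r)) := by
  have h1 := (hasSum_exp (c ^ 2 / 2)).mul_right (Real.exp (c * r))
  have hs : Summable fun p : ℕ × ℕ => majorantTerm c r p.1 p.2 := by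
    rw [summable_prod_of_nonneg fun p => majorantTerm_nonneg hc hr p.1 p.2]
    refine ⟨fun m => (hasSum_majorantTerm_right c r m).summable, ?_⟩
    simp only [(hasSum_majorantTerm_right c r _).tsum_eq]
    exact h1.summable
  have h2 := hs.hasSum.prod_fiberwise fun m => hasSum_majorantTerm_right c r m
  rw [← h2.unique h1]
  exact hs.hasSum

/-- The majorant of `e^{-Δ/2} E_n`. -/
def majorant (c r : ℝ) (n : ℕ) : ℝ := ∑' m, majorantTerm c r m n

theorem summable_majorantTerm_left {c r : ℝ} (hc : 0 ≤ c) (hr : 0 ≤ r) (n : ℕ) :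
    Summable fun m => majorantTerm c r m n :=
  ((Equiv.prodComm ℕ ℕ).summable_iff.2 (hasSum_majorantTerm hc hr).summable).prod_factor n

theorem hasSum_majorant {c r : ℝ} (hc : 0 ≤ c) (hr : 0 ≤ r) :
    HasSum (majorant c r) (Real.exp (c ^ 2 / 2) * Real.exp (c * r)) :=
  ((Equiv.prodComm ℕ ℕ).hasSum_iff.2 (hasSum_majorantTerm hc hr)).prod_fiberwise fun n =>
    (summable_majorantTerm_left hc hr n).hasSum

theorem norm_heatCoeff (m : ℕ) : ‖heatCoeff m‖ = (1 / 2) ^ m / m.factorial := by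
  simp [heatCoeff]

theorem norm_toFun_heat_le {c : ℝ} (hc : 0 ≤ c) {n : ℕ} {f : Poly d}
    (hf : Majorized (Polynomial.C (c ^ n / n.factorial) * Polynomial.X ^ n) f) (y : Space d) :
    ‖toFun (heat f) y‖ ≤ majorant c ‖y‖ n := by
  obtain ⟨N, hN⟩ := exists_polyLap_pow_eq_zero f
  rw [heat_eq_sum hN, toFun_sum]
  refine (norm_sum_le_of_le _ fun m _ => ?_).trans
    ((summable_majorantTerm_left hc (norm_nonneg y) n).sum_le_tsum (Finset.range N)
      fun m _ => majorantTerm_nonneg hc (norm_nonneg y) m n)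
  rw [toFun_smul, norm_mul, norm_heatCoeff]
  exact mul_le_mul_of_nonneg_left ((hf.polyLap_pow m).norm_toFun_le y) (by positivity)

end Estimates

/-! ### The Gaussian measure -/

section Gaussian

open MeasureTheory

/-- The density of the Gaussian measure. -/
def gaussDensity (z : Space d) : ℝ :=
  ((2 * Real.pi) ^ ((d : ℝ) / 2))⁻¹ * Real.exp (-‖z‖ ^ 2 / 2)

theorem gaussDensity_nonneg (z : Space d) : 0 ≤ gaussDensity z := by
  unfold gaussDensity
  positivity

theorem measurable_gaussDensity : Measurable (gaussDensity (d := d)) := by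
  unfold gaussDensity
  fun_prop

theorem gaussian_eq_withDensity :
    gaussian d = volume.withDensity fun z => ENNReal.ofReal (gaussDensity z) := rfl

theorem integral_gaussian (f : Space d → ℂ) :
    ∫ z, f z ∂gaussian d = ∫ z, f z * (gaussDensity z : ℂ) := by
  rw [gaussian_eq_withDensity, integral_withDensity_eq_integral_toReal_smul
    measurable_gaussDensity.ennreal_ofReal (by simp)]
  refine integral_congr_ae (ae_of_all _ fun z => ?_)
  simp only
  rw [ENNReal.toReal_ofReal (gaussDensity_nonneg z), Complex.real_smul, mul_comm]

theorem integrable_gaussian_iff {f : Space d → ℂ} :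
    Integrable f (gaussian d) ↔ Integrable fun z => f z * (gaussDensity z : ℂ) := by
  rw [gaussian_eq_withDensity, integrable_withDensity_iff_integrable_smul'
    measurable_gaussDensity.ennreal_ofReal (by simp)]
  refine integrable_congr (ae_of_all _ fun z => ?_)
  simp only
  rw [ENNReal.toReal_ofReal (gaussDensity_nonneg z), Complex.real_smul, mul_comm]

theorem integral_gaussian_one : ∫ _, (1 : ℂ) ∂gaussian d = 1 := by
  rw [integral_gaussian]
  simp only [one_mul]
  rw [integral_complex_ofReal]
  have h : ∫ z : Space d, gaussDensity z = 1 := by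
    have h1 := GaussianFourier.integral_rexp_neg_mul_sq_norm (V := Space d) (b := 1 / 2)
      (by norm_num)
    simp only [gaussDensity]
    rw [integral_const_mul]
    have h2 : ∀ z : Space d, -‖z‖ ^ 2 / 2 = -(1 / 2) * ‖z‖ ^ 2 := fun z => by ring
    simp only [h2]
    rw [h1, finrank_euclideanSpace_fin, show Real.pi / (1 / 2) = 2 * Real.pi by ring]
    exact inv_mul_cancel₀ (Real.rpow_pos_of_pos (by positivity) _).ne'
  rw [h, Complex.ofReal_one]

theorem integrable_exp_norm (c : ℝ) :
    Integrable (fun y : Space d => Real.exp (c * ‖y‖)) (gaussian d) := by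
  have h : Integrable (fun y : Space d => ((Real.exp (c * ‖y‖) : ℝ) : ℂ)) (gaussian d) := by
    rw [integrable_gaussian_iff]
    have h1 := (GaussianFourier.integrable_cexp_neg_mul_sq_norm_add (V := Space d) (b := 1 / 4)
      (by norm_num) 0 0).norm.const_mul
        (((2 * Real.pi) ^ ((d : ℝ) / 2))⁻¹ * Real.exp (c ^ 2))
    refine h1.mono' ?_ (ae_of_all _ fun y => ?_)
    · refine Measurable.aestronglyMeasurable ?_
      have := measurable_gaussDensity (d := d)
      fun_prop
    · rw [norm_mul, Complex.norm_real, Complex.norm_real, Real.norm_of_nonneg (Real.exp_nonneg _),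
        Real.norm_of_nonneg (gaussDensity_nonneg y), gaussDensity, Complex.norm_exp, mul_left_comm,
        mul_assoc, ← Real.exp_add, ← Real.exp_add]
      refine mul_le_mul_of_nonneg_left (Real.exp_le_exp.2 ?_) (by positivity)
      have : (-(1 / 4 : ℂ) * (‖y‖ : ℂ) ^ 2 + 0 * ((⟪0, y⟫_ℝ : ℝ) : ℂ)).re = -(1 / 4) * ‖y‖ ^ 2 := by
        rw [zero_mul, add_zero, ← Complex.ofReal_pow]
        rw [Complex.re_mul_ofReal]
        norm_num
      rw [this]
      -- `c ‖y‖ ≤ c² + ‖y‖² / 4` leaves half of the Gaussian exponent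
      nlinarith [sq_nonneg (‖y‖ / 2 - c)]
  exact h.re

instance isFiniteMeasure_gaussian : IsFiniteMeasure (gaussian d) := by
  have := integrable_exp_norm (d := d) 0
  simp only [zero_mul, Real.exp_zero] at this
  exact (integrable_const_iff_isFiniteMeasure one_ne_zero).1 this

/-- Functions of at most exponential growth. -/
def ExpGrowth (f : Space d → ℂ) : Prop := ∃ C c : ℝ, 0 ≤ C ∧ ∀ y, ‖f y‖ ≤ C * Real.exp (c * ‖y‖)

theorem ExpGrowth.mul {f g : Space d → ℂ} (hf : ExpGrowth f) (hg : ExpGrowth g) :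
    ExpGrowth fun y => f y * g y := by
  obtain ⟨C, c, hC, hf⟩ := hf
  obtain ⟨D, e, hD, hg⟩ := hg
  refine ⟨C * D, c + e, mul_nonneg hC hD, fun y => ?_⟩
  rw [norm_mul, add_mul, Real.exp_add, mul_mul_mul_comm]
  exact mul_le_mul (hf y) (hg y) (norm_nonneg _) (by positivity)

theorem ExpGrowth.add {f g : Space d → ℂ} (hf : ExpGrowth f) (hg : ExpGrowth g) :
    ExpGrowth fun y => f y + g y := by
  obtain ⟨C, c, hC, hf⟩ := hf
  obtain ⟨D, e, hD, hg⟩ := hg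
  refine ⟨C + D, max c e, add_nonneg hC hD, fun y => ?_⟩
  rw [add_mul]
  refine (norm_add_le _ _).trans (add_le_add ((hf y).trans ?_) ((hg y).trans ?_))
  · gcongr
    exact le_max_left _ _
  · gcongr
    exact le_max_right _ _

theorem ExpGrowth.integrable {f : Space d → ℂ} (hf : ExpGrowth f)
    (hm : AEStronglyMeasurable f (gaussian d)) : Integrable f (gaussian d) := by
  obtain ⟨C, c, -, hf⟩ := hf
  exact ((integrable_exp_norm c).const_mul C).mono' hm (ae_of_all _ hf)

theorem ExpGrowth.memLp_two {f : Space d → ℂ} (hf : ExpGrowth f)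
    (hm : AEStronglyMeasurable f (gaussian d)) : MemLp f 2 (gaussian d) := by
  rw [memLp_two_iff_integrable_sq_norm hm]
  have h := (hf.mul hf).integrable (hm.mul hm)
  refine h.norm.congr (ae_of_all _ fun y => ?_)
  simp only [norm_mul, sq]

theorem expGrowth_toFun (p : Poly d) : ExpGrowth (toFun p) := by
  induction p using poly_induction with
  | hC c => exact ⟨‖c‖, 0, norm_nonneg c, fun y => by simp⟩
  | hadd p q hp hq =>
    rw [show toFun (p + q) = fun y => toFun p y + toFun q y from funext fun y => toFun_add p q y]
    exact hp.add hq
  | hmul u p hp =>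
    have h : ExpGrowth (toFun (linForm u)) := by
      refine ⟨‖u‖, 1, norm_nonneg u, fun y => ?_⟩
      rw [toFun_linForm, Complex.norm_real, one_mul]
      refine (norm_inner_le_norm y u).trans ?_
      rw [mul_comm]
      refine mul_le_mul_of_nonneg_left ?_ (norm_nonneg u)
      linarith [Real.add_one_le_exp ‖y‖]
    rw [show toFun (linForm u * p) = fun y => toFun (linForm u) y * toFun p y from
      funext fun y => toFun_mul _ p y]
    exact h.mul hp

theorem integrable_toFun (p : Poly d) : Integrable (toFun p) (gaussian d) :=
  (expGrowth_toFun p).integrable (continuous_toFun p).aestronglyMeasurable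

theorem memLp_toFun (p : Poly d) : MemLp (toFun p) 2 (gaussian d) :=
  (expGrowth_toFun p).memLp_two (continuous_toFun p).aestronglyMeasurable

theorem hasFDerivAt_gaussDensity (z : Space d) :
    HasFDerivAt (fun z : Space d => (gaussDensity z : ℂ))
      (Complex.ofRealCLM.comp (-(gaussDensity z) • innerSL ℝ z)) z := by
  refine Complex.ofRealCLM.hasFDerivAt.comp z ?_
  have h1 : HasFDerivAt (fun z : Space d => -‖z‖ ^ 2 / 2) (-(innerSL ℝ z)) z := by
    have h := ((hasFDerivAt_id z).norm_sq).const_mul (-1 / 2 : ℝ)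
    refine (h.congr_fderiv ?_).congr_of_eventuallyEq (Filter.Eventually.of_forall fun w => ?_)
    · ext w
      simp
      ring
    · simp only [id]
      ring
  have h2 := (h1.exp).const_mul (((2 * Real.pi) ^ ((d : ℝ) / 2))⁻¹)
  refine h2.congr_fderiv ?_
  ext w
  simp [gaussDensity, mul_assoc]

/-- Integration by parts for polynomials with respect to the Gaussian measure. -/
theorem integral_dirDeriv (u : Space d) (p : Poly d) :
    ∫ y, toFun (dirDeriv u p) y ∂gaussian d = ∫ y, toFun (linForm u * p) y ∂gaussian d := by
  have h1 (x : Space d) : fderiv ℝ (fun z : Space d => (gaussDensity z : ℂ)) x u =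
      -(((⟪x, u⟫_ℝ : ℝ) : ℂ) * (gaussDensity x : ℂ)) := by
    rw [(hasFDerivAt_gaussDensity x).fderiv]
    simp [mul_comm]
  have h2 (x : Space d) : toFun p x * fderiv ℝ (fun z : Space d => (gaussDensity z : ℂ)) x u =
      -(toFun (linForm u * p) x * (gaussDensity x : ℂ)) := by
    rw [h1, toFun_mul, toFun_linForm]
    ring
  have h := integral_mul_fderiv_eq_neg_fderiv_mul_of_integrable (μ := (volume : Measure (Space d)))
    (f := toFun p) (g := fun z : Space d => (gaussDensity z : ℂ)) (v := u)
    (by simpa only [fderiv_toFun] using integrable_gaussian_iff.1 (integrable_toFun (dirDeriv u p)))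
    (by
      simp only [h2]
      exact (integrable_gaussian_iff.1 (integrable_toFun (linForm u * p))).neg)
    (integrable_gaussian_iff.1 (integrable_toFun p))
    (fun x _ => differentiable_toFun p x)
    (fun x _ => (hasFDerivAt_gaussDensity x).differentiableAt)
  simp only [h2, fderiv_toFun, integral_neg, neg_inj] at h
  rw [integral_gaussian, integral_gaussian, h]

/-- The bilinear form `∫ (e^{-Δ/2} p) (e^{-Δ/2} q) dγ` on polynomials. -/
def gaussPair (p q : Poly d) : ℂ := ∫ y, toFun (heat p * heat q) y ∂gaussian d

/-- With respect to the Gaussian pairing, multiplication by a linear form is adjoint to the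
directional derivative. -/
theorem gaussPair_linForm_mul (u : Space d) (p q : Poly d) :
    gaussPair (linForm u * p) q = gaussPair p (dirDeriv u q) := by
  have h := integral_dirDeriv u (heat p * heat q)
  have h1 : linForm u * (heat p * heat q) = heat (linForm u * p) * heat q +
      dirDeriv u (heat p) * heat q := by
    rw [heat_linForm_mul]
    ring
  rw [h1, dirDeriv_mul] at h
  simp only [toFun_add] at h
  rw [integral_add (integrable_toFun _) (integrable_toFun _),
    integral_add (integrable_toFun _) (integrable_toFun _), add_comm, add_left_inj] at h
  rw [gaussPair, gaussPair, heat_dirDeriv, h]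

theorem gaussPair_add_left (p p' q : Poly d) :
    gaussPair (p + p') q = gaussPair p q + gaussPair p' q := by
  rw [gaussPair, gaussPair, gaussPair, heat_add, add_mul,
    ← integral_add (integrable_toFun _) (integrable_toFun _)]
  simp only [toFun_add]

theorem gaussPair_smul_left (c : ℂ) (p q : Poly d) :
    gaussPair (c • p) q = c * gaussPair p q := by
  rw [gaussPair, gaussPair, heat_smul, smul_mul_assoc, ← integral_const_mul]
  simp only [toFun_smul]

theorem gaussPair_zero_right (p : Poly d) : gaussPair p 0 = 0 := by
  have : heat (0 : Poly d) = 0 := heatLin.map_zero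
  rw [gaussPair, this, mul_zero]
  simp

theorem gaussPair_one_left (q : Poly d) : gaussPair 1 q = toFun q 0 := by
  have h1 : heat (1 : Poly d) = 1 := by simpa using heat_C (d := d) 1
  simp only [gaussPair, h1, one_mul]
  induction q using poly_induction with
  | hC c =>
    rw [heat_C]
    simp only [toFun_C]
    have := integral_const_mul (μ := gaussian d) c fun _ => (1 : ℂ)
    rwa [integral_gaussian_one, mul_one] at this
  | hadd p q hp hq =>
    rw [heat_add, toFun_add, ← hp, ← hq,
      ← integral_add (integrable_toFun _) (integrable_toFun _)]
    simp only [toFun_add]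
  | hmul u q _ =>
    rw [heat_linForm_mul, toFun_mul, toFun_linForm, inner_zero_left, Complex.ofReal_zero, zero_mul]
    simp only [toFun_sub]
    rw [integral_sub (integrable_toFun _) (integrable_toFun _), integral_dirDeriv, sub_self]

/-- A square integrable function orthogonal to all polynomials has vanishing Fourier transform. -/
theorem integral_mul_cexp_eq_zero {F : Space d → ℂ} (hF : MemLp F 2 (gaussian d))
    (h : ∀ q : Poly d, ∫ y, F y * toFun q y ∂gaussian d = 0) (t : Space d) :
    ∫ y, F y * Complex.exp (((⟪y, t⟫_ℝ : ℝ) : ℂ) * Complex.I) ∂gaussian d = 0 := by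
  have hexp (x : ℂ) : HasSum (fun n : ℕ => x ^ n / n.factorial) (Complex.exp x) := by
    rw [Complex.exp_eq_exp_ℂ]
    exact NormedSpace.expSeries_div_hasSum_exp x
  let q (n : ℕ) : Poly d := (Complex.I ^ n / n.factorial) • linForm t ^ n
  have hq (n : ℕ) (y : Space d) :
      toFun (q n) y = (((⟪y, t⟫_ℝ : ℝ) : ℂ) * Complex.I) ^ n / n.factorial := by
    simp only [q, toFun_smul, toFun_pow, toFun_linForm]
    ring
  have hbd : Integrable (fun y => ‖F y‖ * Real.exp (‖t‖ * ‖y‖)) (gaussian d) := by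
    have hE : MemLp (fun y : Space d => ((Real.exp (‖t‖ * ‖y‖) : ℝ) : ℂ)) 2 (gaussian d) := by
      refine ExpGrowth.memLp_two ⟨1, ‖t‖, zero_le_one, fun y => ?_⟩ ?_
      · rw [Complex.norm_real, Real.norm_of_nonneg (Real.exp_nonneg _), one_mul]
      · refine Continuous.aestronglyMeasurable ?_
        fun_prop
    refine (hF.integrable_mul hE).norm.congr (ae_of_all _ fun y => ?_)
    simp only [Pi.mul_apply, norm_mul, Complex.norm_real, Real.norm_of_nonneg (Real.exp_nonneg _)]
  have hsum := hasSum_integral_of_dominated_convergence (μ := gaussian d)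
    (F := fun n y => F y * toFun (q n) y)
    (f := fun y => F y * Complex.exp (((⟪y, t⟫_ℝ : ℝ) : ℂ) * Complex.I))
    (fun n y => ‖F y‖ * ((‖t‖ * ‖y‖) ^ n / n.factorial))
    (fun n => hF.aestronglyMeasurable.mul (continuous_toFun _).aestronglyMeasurable)
    (fun n => ae_of_all _ fun y => by
      rw [norm_mul, hq, norm_div, norm_pow, norm_mul, Complex.norm_real, Complex.norm_I, mul_one,
        Complex.norm_natCast]
      have := norm_inner_le_norm (𝕜 := ℝ) t y
      rw [real_inner_comm] at this
      gcongr)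
    (ae_of_all _ fun y => ((hasSum_exp (‖t‖ * ‖y‖)).mul_left ‖F y‖).summable)
    (hbd.congr (ae_of_all _ fun y => ((hasSum_exp (‖t‖ * ‖y‖)).mul_left ‖F y‖).tsum_eq.symm))
    (ae_of_all _ fun y => by
      simp only [hq]
      exact (hexp _).mul_left (F y))
  simp only [h] at hsum
  exact hsum.unique hasSum_zero

/-- An integrable real function with vanishing Fourier transform vanishes: its positive and
negative parts are densities of measures with the same characteristic function. -/
theorem ae_eq_zero_of_integral_mul_cexp {μ : Measure (Space d)} {F : Space d → ℝ}
    (hF : Integrable F μ)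
    (h : ∀ t, ∫ y, (F y : ℂ) * Complex.exp (((⟪y, t⟫_ℝ : ℝ) : ℂ) * Complex.I) ∂μ = 0) :
    F =ᵐ[μ] 0 := by
  have hfin (G : Space d → ℝ) (hG : Integrable G μ) :
      IsFiniteMeasure (μ.withDensity fun y => ENNReal.ofReal (G y)) :=
    isFiniteMeasure_withDensity_ofReal hG.2
  have := hfin F hF
  have := hfin (fun y => -F y) hF.neg
  have hm : AEMeasurable (fun y => ENNReal.ofReal (F y)) μ := hF.aemeasurable.ennreal_ofReal
  have hm' : AEMeasurable (fun y => ENNReal.ofReal (-F y)) μ := hF.neg.aemeasurable.ennreal_ofReal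
  have he (t : Space d) : Continuous fun y : Space d =>
      Complex.exp (((⟪y, t⟫_ℝ : ℝ) : ℂ) * Complex.I) := by fun_prop
  have hint (G : Space d → ℝ) (hG : Integrable G μ) (t : Space d) :
      Integrable (fun y => (ENNReal.ofReal (G y)).toReal •
        Complex.exp (((⟪y, t⟫_ℝ : ℝ) : ℂ) * Complex.I)) μ := by
    refine hG.norm.mono' ?_ (ae_of_all _ fun y => ?_)
    · exact (hG.aemeasurable.ennreal_ofReal.ennreal_toReal.aestronglyMeasurable).smul
        (he t).aestronglyMeasurable
    · rw [norm_smul, Complex.norm_exp_ofReal_mul_I, mul_one, ENNReal.toReal_ofReal',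
        Real.norm_of_nonneg (le_max_right _ _)]
      exact max_le (le_abs_self _) (abs_nonneg _)
  have heq : (μ.withDensity fun y => ENNReal.ofReal (F y)) =
      μ.withDensity fun y => ENNReal.ofReal (-F y) := by
    refine Measure.ext_of_charFun (funext fun t => ?_)
    rw [charFun_apply, charFun_apply, integral_withDensity_eq_integral_toReal_smul₀ hm (by simp),
      integral_withDensity_eq_integral_toReal_smul₀ hm' (by simp), ← sub_eq_zero,
      ← integral_sub (hint F hF t) (hint (fun y => -F y) hF.neg t), ← h t]
    refine integral_congr_ae (ae_of_all _ fun y => ?_)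
    simp only
    rw [← sub_smul, ENNReal.toReal_ofReal', ENNReal.toReal_ofReal', Complex.real_smul,
      max_zero_sub_eq_self]
  have hlt : ∫⁻ y, ENNReal.ofReal (F y) ∂μ ≠ ⊤ := by
    have := measure_ne_top (μ.withDensity fun y => ENNReal.ofReal (F y)) Set.univ
    rwa [withDensity_apply _ MeasurableSet.univ, Measure.restrict_univ] at this
  filter_upwards [(withDensity_eq_iff hm hm' hlt).1 heq] with y hy
  have h1 := congrArg ENNReal.toReal hy
  rw [ENNReal.toReal_ofReal', ENNReal.toReal_ofReal', ← sub_eq_zero, max_zero_sub_eq_self] at h1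
  exact h1

/-- Polynomials are total in `L²` of the Gaussian measure. -/
theorem ae_eq_zero_of_integral_mul_toFun {F : Space d → ℂ} (hF : MemLp F 2 (gaussian d))
    (h : ∀ q : Poly d, ∫ y, F y * toFun q y ∂gaussian d = 0) : F =ᵐ[gaussian d] 0 := by
  have hFi : Integrable F (gaussian d) := hF.integrable one_le_two
  have h1 := integral_mul_cexp_eq_zero hF h
  have hexp (t : Space d) : Continuous fun y : Space d =>
      Complex.exp (((⟪y, t⟫_ℝ : ℝ) : ℂ) * Complex.I) := by fun_prop
  have hint {G : Space d → ℂ} (hG : Integrable G (gaussian d)) (t : Space d) :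
      Integrable (fun y => G y * Complex.exp (((⟪y, t⟫_ℝ : ℝ) : ℂ) * Complex.I)) (gaussian d) := by
    refine hG.norm.mono' (hG.1.mul (hexp t).aestronglyMeasurable) (ae_of_all _ fun y => ?_)
    rw [norm_mul, Complex.norm_exp_ofReal_mul_I, mul_one]
  have h2 (t : Space d) : ∫ y, (starRingEnd ℂ) (F y) *
      Complex.exp (((⟪y, t⟫_ℝ : ℝ) : ℂ) * Complex.I) ∂gaussian d = 0 := by
    rw [← map_zero (starRingEnd ℂ), ← h1 (-t), ← integral_conj]
    refine integral_congr_ae (ae_of_all _ fun y => ?_)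
    simp only [map_mul, ← Complex.exp_conj, Complex.conj_I, Complex.conj_ofReal, inner_neg_right]
    push_cast
    rw [neg_mul_neg]
  have hFc : Integrable (fun y => (starRingEnd ℂ) (F y)) (gaussian d) :=
    hFi.norm.mono' (Complex.continuous_conj.comp_aestronglyMeasurable hFi.1)
      (ae_of_all _ fun y => by simp)
  have hre : (fun y => (F y).re) =ᵐ[gaussian d] 0 := by
    refine ae_eq_zero_of_integral_mul_cexp hFi.re fun t => ?_
    have e (y : Space d) : ((F y).re : ℂ) * Complex.exp (((⟪y, t⟫_ℝ : ℝ) : ℂ) * Complex.I) =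
        2⁻¹ * (F y * Complex.exp (((⟪y, t⟫_ℝ : ℝ) : ℂ) * Complex.I) +
          (starRingEnd ℂ) (F y) * Complex.exp (((⟪y, t⟫_ℝ : ℝ) : ℂ) * Complex.I)) := by
      rw [← add_mul, Complex.add_conj]
      push_cast
      ring
    simp only [e]
    rw [integral_const_mul, integral_add (hint hFi t) (hint hFc t), h1, h2, add_zero, mul_zero]
  have him : (fun y => (F y).im) =ᵐ[gaussian d] 0 := by
    refine ae_eq_zero_of_integral_mul_cexp hFi.im fun t => ?_
    have e (y : Space d) : ((F y).im : ℂ) * Complex.exp (((⟪y, t⟫_ℝ : ℝ) : ℂ) * Complex.I) =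
        (2 * Complex.I)⁻¹ * (F y * Complex.exp (((⟪y, t⟫_ℝ : ℝ) : ℂ) * Complex.I) -
          (starRingEnd ℂ) (F y) * Complex.exp (((⟪y, t⟫_ℝ : ℝ) : ℂ) * Complex.I)) := by
      rw [← sub_mul, Complex.sub_conj]
      push_cast
      field_simp
    simp only [e]
    rw [integral_const_mul, integral_sub (hint hFi t) (hint hFc t), h1, h2, sub_zero, mul_zero]
  filter_upwards [hre, him] with y hr hi
  exact Complex.ext hr hi

end Gaussian

/-! ### The integral kernel -/

section IntegralKernel

open MeasureTheory

theorem toFun_zero_of_mem_homog {n : ℕ} {p : Poly d} (hp : p ∈ homog d (n + 1)) :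
    toFun p 0 = 0 := by
  have h := congrArg (fun q => toFun q 0) (euler_identity hp)
  simp only [toFun_sum, toFun_mul, toFun_X, toFun_smul, PiLp.zero_apply, Complex.ofReal_zero,
    zero_mul, Finset.sum_const_zero] at h
  exact (mul_eq_zero.1 h.symm).resolve_left (Nat.cast_ne_zero.2 n.succ_ne_zero)

variable {R : Finset (Space d)} {β : Space d} {k : Space d → ℂ}

theorem gaussPair_sum_left {ι : Type*} (s : Finset ι) (f : ι → Poly d) (q : Poly d) :
    gaussPair (∑ i ∈ s, f i) q = ∑ i ∈ s, gaussPair (f i) q := by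
  let φ : Poly d →+ ℂ :=
    AddMonoidHom.mk' (fun p => gaussPair p q) fun p p' => gaussPair_add_left p p' q
  exact map_sum φ f s

/-- `E_n(x, ·)` represents `p ↦ V p (x)` on homogeneous polynomials of degree `n` for the Gaussian
pairing, and it is orthogonal to the other degrees. -/
theorem gaussPair_kernelPoly [Fintype (reflGroup R)] {V : Poly d ≃ₗ[ℂ] Poly d}
    (hV : IsIntertwining R β k V) (hk : k ∈ MStar R β) {lam : ℕ → reflGroup R → ℂ} {δ : ℝ}
    (hlam : IsCoeffBound R β k lam δ) (n m : ℕ) (x : Space d) {p : Poly d} (hp : p ∈ homog d m) :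
    gaussPair (kernelPoly lam n x) p = if n = m then toFun (V p) x else 0 := by
  induction n generalizing m x p with
  | zero =>
    rw [kernelPoly, gaussPair_one_left]
    rcases m with _ | m
    · obtain ⟨c, rfl⟩ := homog_zero hp
      simp [hV.map_C]
    · rw [toFun_zero_of_mem_homog hp, if_neg (Nat.succ_ne_zero m).symm]
  | succ n ih =>
    have h : gaussPair (kernelPoly lam (n + 1) x) p =
        ∑ g : reflGroup R, lam (n + 1) g * gaussPair (kernelPoly lam n (g.1 x))
          (dirDeriv (g.1 x) p) := by
      rw [kernelPoly, gaussPair_sum_left]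
      simp only [gaussPair_smul_left, gaussPair_linForm_mul]
    rw [h]
    rcases m with _ | m
    · obtain ⟨c, rfl⟩ := homog_zero hp
      simp [gaussPair_zero_right]
    · simp only [ih m _ (dirDeriv_mem_homog _ hp), Nat.add_right_cancel_iff]
      split_ifs with hnm
      · subst hnm
        rw [hV.toFun_succ hk hlam hp]
      · simp

/-- The kernel `L_k`, defined by its series. -/
def integralKernel (R : Finset (Space d)) (β : Space d) (k : Space d → ℂ) (x y : Space d) : ℂ :=
  ∑' n, expNegHalfLaplacian (homogKernel R β k n x) y

theorem hasSum_integralKernel (hR : IsRootSystem R) (hβ : ∀ α ∈ R, ⟪α, β⟫_ℝ ≠ 0)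
    (hk : k ∈ MStar R β) {lam : ℕ → reflGroup R → ℂ} {δ : ℝ} (hlam : IsCoeffBound R β k lam δ)
    (x y : Space d) :
    (∀ n, ‖expNegHalfLaplacian (homogKernel R β k n x) y‖ ≤
      majorant (δ * Nat.card (reflGroup R) * ‖x‖) ‖y‖ n) ∧
    HasSum (fun n => expNegHalfLaplacian (homogKernel R β k n x) y)
      (integralKernel R β k x y) := by
  have := hR.finite_reflGroup
  have := Fintype.ofFinite (reflGroup R)
  have hc : 0 ≤ δ * Nat.card (reflGroup R) * ‖x‖ := by
    have := hlam.pos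
    positivity
  have h (n : ℕ) : ‖expNegHalfLaplacian (homogKernel R β k n x) y‖ ≤
      majorant (δ * Nat.card (reflGroup R) * ‖x‖) ‖y‖ n := by
    rw [homogKernel_eq_toFun hR hβ hk hlam, expNegHalfLaplacian_toFun]
    exact norm_toFun_heat_le hc (majorized_kernelPoly hlam n x) y
  exact ⟨h, (Summable.of_norm_bounded (hasSum_majorant hc (norm_nonneg y)).summable h).hasSum⟩

theorem norm_integralKernel_le (hR : IsRootSystem R) (hβ : ∀ α ∈ R, ⟪α, β⟫_ℝ ≠ 0)
    (hk : k ∈ MStar R β) {lam : ℕ → reflGroup R → ℂ} {δ : ℝ} (hlam : IsCoeffBound R β k lam δ)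
    (x y : Space d) : ‖integralKernel R β k x y‖ ≤
      Real.exp ((δ * Nat.card (reflGroup R) * ‖x‖) ^ 2 / 2) *
        Real.exp (δ * Nat.card (reflGroup R) * ‖x‖ * ‖y‖) := by
  have hc : 0 ≤ δ * Nat.card (reflGroup R) * ‖x‖ := by
    have := hlam.pos
    positivity
  exact tsum_of_norm_bounded (hasSum_majorant hc (norm_nonneg y))
    (hasSum_integralKernel hR hβ hk hlam x y).1

theorem continuous_expNegHalfLaplacian_homogKernel (hR : IsRootSystem R)
    (hβ : ∀ α ∈ R, ⟪α, β⟫_ℝ ≠ 0) (hk : k ∈ MStar R β) (n : ℕ) (x : Space d) :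
    Continuous (expNegHalfLaplacian (homogKernel R β k n x)) := by
  have := hR.finite_reflGroup
  have := Fintype.ofFinite (reflGroup R)
  obtain ⟨lam, δ, hlam⟩ := exists_isCoeffBound hR hk
  rw [homogKernel_eq_toFun hR hβ hk hlam, expNegHalfLaplacian_toFun]
  exact continuous_toFun _

theorem expGrowth_integralKernel (hR : IsRootSystem R) (hβ : ∀ α ∈ R, ⟪α, β⟫_ℝ ≠ 0)
    (hk : k ∈ MStar R β) (x : Space d) : ExpGrowth (integralKernel R β k x) := by
  obtain ⟨lam, δ, hlam⟩ := exists_isCoeffBound hR hk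
  exact ⟨_, _, (Real.exp_nonneg _), norm_integralKernel_le hR hβ hk hlam x⟩

theorem aestronglyMeasurable_integralKernel (hR : IsRootSystem R) (hβ : ∀ α ∈ R, ⟪α, β⟫_ℝ ≠ 0)
    (hk : k ∈ MStar R β) (x : Space d) :
    AEStronglyMeasurable (integralKernel R β k x) (gaussian d) := by
  obtain ⟨lam, δ, hlam⟩ := exists_isCoeffBound hR hk
  refine aestronglyMeasurable_of_tendsto_ae Filter.atTop
    (f := fun N y => ∑ n ∈ Finset.range N, expNegHalfLaplacian (homogKernel R β k n x) y)
    (fun N => Continuous.aestronglyMeasurable ?_)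
    (ae_of_all _ fun y => (hasSum_integralKernel hR hβ hk hlam x y).2.tendsto_sum_nat)
  exact continuous_finsetSum _ fun n _ =>
    continuous_expNegHalfLaplacian_homogKernel hR hβ hk n x

theorem memLp_integralKernel (hR : IsRootSystem R) (hβ : ∀ α ∈ R, ⟪α, β⟫_ℝ ≠ 0)
    (hk : k ∈ MStar R β) (x : Space d) : MemLp (integralKernel R β k x) 2 (gaussian d) :=
  (expGrowth_integralKernel hR hβ hk x).memLp_two (aestronglyMeasurable_integralKernel hR hβ hk x)

theorem integrable_integralKernel_mul (hR : IsRootSystem R) (hβ : ∀ α ∈ R, ⟪α, β⟫_ℝ ≠ 0)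
    (hk : k ∈ MStar R β) (x : Space d) (q : Poly d) :
    Integrable (fun y => integralKernel R β k x y * toFun q y) (gaussian d) :=
  ((expGrowth_integralKernel hR hβ hk x).mul (expGrowth_toFun q)).integrable
    ((aestronglyMeasurable_integralKernel hR hβ hk x).mul
      (continuous_toFun q).aestronglyMeasurable)

/-- The integral representation on homogeneous polynomials: the series of the kernel may be
integrated term by term, and only one term contributes. -/
theorem integral_integralKernel_of_homog (hR : IsRootSystem R) (hβ : ∀ α ∈ R, ⟪α, β⟫_ℝ ≠ 0)
    (hk : k ∈ MStar R β) (x : Space d) {m : ℕ} {p : Poly d} (hp : p ∈ homog d m) :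
    ∫ y, integralKernel R β k x y * toFun (heat p) y ∂gaussian d =
      toFun (intertwiner R β k p) x := by
  have := hR.finite_reflGroup
  have := Fintype.ofFinite (reflGroup R)
  obtain ⟨lam, δ, hlam⟩ := exists_isCoeffBound hR hk
  have hV := isIntertwining_intertwiner hR hβ hk
  have hc : 0 ≤ δ * Nat.card (reflGroup R) * ‖x‖ := by
    have := hlam.pos
    positivity
  have hmaj (y : Space d) := (hasSum_majorant hc (norm_nonneg y)).mul_right ‖toFun (heat p) y‖
  have hbd : Integrable (fun y => Real.exp ((δ * Nat.card (reflGroup R) * ‖x‖) ^ 2 / 2) *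
      Real.exp (δ * Nat.card (reflGroup R) * ‖x‖ * ‖y‖) * ‖toFun (heat p) y‖) (gaussian d) := by
    have hE : ExpGrowth fun y : Space d =>
        ((Real.exp ((δ * Nat.card (reflGroup R) * ‖x‖) ^ 2 / 2) *
          Real.exp (δ * Nat.card (reflGroup R) * ‖x‖ * ‖y‖) : ℝ) : ℂ) :=
      ⟨_, _, Real.exp_nonneg _, fun y => by
        rw [Complex.norm_real, Real.norm_of_nonneg (by positivity)]⟩
    refine ((hE.mul (expGrowth_toFun (heat p))).integrable ?_).norm.congr (ae_of_all _ fun y => ?_)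
    · have := continuous_toFun (heat p)
      refine Continuous.aestronglyMeasurable ?_
      fun_prop
    · simp only
      rw [norm_mul, Complex.norm_real, Real.norm_of_nonneg (by positivity)]
  have hsum := hasSum_integral_of_dominated_convergence (μ := gaussian d)
    (F := fun n y => expNegHalfLaplacian (homogKernel R β k n x) y * toFun (heat p) y)
    (f := fun y => integralKernel R β k x y * toFun (heat p) y)
    (fun n y => majorant (δ * Nat.card (reflGroup R) * ‖x‖) ‖y‖ n * ‖toFun (heat p) y‖)
    (fun n => ((continuous_expNegHalfLaplacian_homogKernel hR hβ hk n x).mul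
      (continuous_toFun _)).aestronglyMeasurable)
    (fun n => ae_of_all _ fun y => by
      rw [norm_mul]
      exact mul_le_mul_of_nonneg_right ((hasSum_integralKernel hR hβ hk hlam x y).1 n)
        (norm_nonneg _))
    (ae_of_all _ fun y => (hmaj y).summable)
    (hbd.congr (ae_of_all _ fun y => (hmaj y).tsum_eq.symm))
    (ae_of_all _ fun y => (hasSum_integralKernel hR hβ hk hlam x y).2.mul_right _)
  have hterm (n : ℕ) : ∫ y, expNegHalfLaplacian (homogKernel R β k n x) y * toFun (heat p) y
      ∂gaussian d = if n = m then toFun (intertwiner R β k p) x else 0 := by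
    rw [← gaussPair_kernelPoly hV hk hlam n m x hp, gaussPair,
      homogKernel_eq_toFun hR hβ hk hlam, expNegHalfLaplacian_toFun]
    simp only [toFun_mul]
  simp only [hterm] at hsum
  exact hsum.unique (hasSum_ite_eq m _)

theorem integral_integralKernel (hR : IsRootSystem R) (hβ : ∀ α ∈ R, ⟪α, β⟫_ℝ ≠ 0)
    (hk : k ∈ MStar R β) (x : Space d) (p : Poly d) :
    ∫ y, integralKernel R β k x y * toFun (heat p) y ∂gaussian d =
      toFun (intertwiner R β k p) x := by
  let φ : Poly d →ₗ[ℂ] ℂ :=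
    { toFun := fun p => ∫ y, integralKernel R β k x y * toFun (heat p) y ∂gaussian d
      map_add' := fun p q => by
        rw [← integral_add (integrable_integralKernel_mul hR hβ hk x _)
          (integrable_integralKernel_mul hR hβ hk x _)]
        simp only [heat_add, toFun_add, mul_add]
      map_smul' := fun c p => by
        simp only [heat_smul, toFun_smul, mul_left_comm _ c, integral_const_mul]
        rfl }
  let ψ : Poly d →ₗ[ℂ] ℂ :=
    { toFun := fun p => toFun (intertwiner R β k p) x
      map_add' := fun p q => by rw [map_add, toFun_add]
      map_smul' := fun c p => by
        rw [map_smul, toFun_smul]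
        rfl }
  have h : φ = ψ := ext_homog fun m p hp => integral_integralKernel_of_homog hR hβ hk x hp
  exact LinearMap.congr_fun h p

theorem integralKernel_unique (hR : IsRootSystem R) (hβ : ∀ α ∈ R, ⟪α, β⟫_ℝ ≠ 0)
    (hk : k ∈ MStar R β) (x : Space d) {F : Space d → ℂ} (hF : MemLp F 2 (gaussian d))
    (h : ∀ p : Poly d, toFun (intertwiner R β k p) x = ∫ y, F y * toFun (heat p) y ∂gaussian d) :
    F =ᵐ[gaussian d] integralKernel R β k x := by
  have h0 := ae_eq_zero_of_integral_mul_toFun (hF.sub (memLp_integralKernel hR hβ hk x))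
    fun q => by
      obtain ⟨p, rfl⟩ := heat_surjective q
      have h1 : Integrable (fun y => F y * toFun (heat p) y) (gaussian d) :=
        hF.integrable_mul (memLp_toFun (heat p))
      simp only [Pi.sub_apply, sub_mul]
      rw [integral_sub h1 (integrable_integralKernel_mul hR hβ hk x _), ← h,
        integral_integralKernel hR hβ hk, sub_self]
  filter_upwards [h0] with y hy
  exact sub_eq_zero.1 hy

/-- The factor `√d` only weakens the bound: either `d ≥ 1`, or `d = 0` and then `x = 0`. -/
theorem sq_mul_norm_le (a : ℝ) (x : Space d) :
    (a * ‖x‖) ^ 2 ≤ (Real.sqrt d * (a * ‖x‖)) ^ 2 := by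
  rcases Nat.eq_zero_or_pos d with rfl | hd
  · rw [Subsingleton.elim x 0]
    simp
  · rw [mul_pow (Real.sqrt d), Real.sq_sqrt (Nat.cast_nonneg d)]
    exact le_mul_of_one_le_left (sq_nonneg _) (Nat.one_le_cast.2 hd)

end IntegralKernel

end Dunkl
end

theorem mainTheorem1 {d : ℕ} (R : Finset (Dunkl.Space d)) (hR : Dunkl.IsRootSystem R)
    (β : Dunkl.Space d) (hβ : ∀ α ∈ R, inner ℝ α β ≠ 0) :
    -- `M*` contains all parameter functions with nonnegative real part
    (∀ k : Dunkl.Space d → ℂ, Dunkl.IsParameter R k → (∀ α ∈ R, 0 ≤ (k α).re) →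
      k ∈ Dunkl.MStar R β) ∧
    ∀ k ∈ Dunkl.MStar R β,
      -- the intertwining operator is well defined
      Dunkl.IsIntertwining R β k (Dunkl.intertwiner R β k) ∧
      (∀ V, Dunkl.IsIntertwining R β k V → V = Dunkl.intertwiner R β k) ∧
      -- so are the coefficients of `H_n` and the constant `δ`
      (∃ lam δ, Dunkl.IsCoeffBound R β k lam δ) ∧
      ∃ L : Dunkl.Space d → Dunkl.Space d → ℂ,
        -- the integral representation
        (∀ x, MeasureTheory.MemLp (L x) 2 (Dunkl.gaussian d)) ∧
        (∀ (p : Dunkl.Poly d) (x : Dunkl.Space d),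
          MeasureTheory.Integrable
            (fun y => L x y * Dunkl.expNegHalfLaplacian (Dunkl.toFun p) y) (Dunkl.gaussian d) ∧
          Dunkl.toFun (Dunkl.intertwiner R β k p) x =
            ∫ y, L x y * Dunkl.expNegHalfLaplacian (Dunkl.toFun p) y ∂(Dunkl.gaussian d)) ∧
        -- uniqueness of the kernel
        (∀ L' : Dunkl.Space d → Dunkl.Space d → ℂ,
          (∀ x, MeasureTheory.MemLp (L' x) 2 (Dunkl.gaussian d)) →
          (∀ (p : Dunkl.Poly d) (x : Dunkl.Space d),
            Dunkl.toFun (Dunkl.intertwiner R β k p) x =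
              ∫ y, L' x y * Dunkl.expNegHalfLaplacian (Dunkl.toFun p) y ∂(Dunkl.gaussian d)) →
          ∀ x, L' x =ᵐ[Dunkl.gaussian d] L x) ∧
        -- the series for the kernel
        (∀ x y, HasSum
          (fun n => Dunkl.expNegHalfLaplacian (Dunkl.homogKernel R β k n x) y) (L x y)) ∧
        -- the bound, for every admissible choice of the constant `δ`
        (∀ lam δ, Dunkl.IsCoeffBound R β k lam δ → ∀ x y,
          ‖L x y‖ ≤
            Real.exp ((δ * Real.sqrt d * Nat.card (Dunkl.reflGroup R) * ‖x‖) ^ 2 / 2) *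
            Real.exp (δ * Nat.card (Dunkl.reflGroup R) * ‖x‖ * ‖y‖)) := by
  refine ⟨fun k hk hre => Dunkl.mem_MStar_of_re_nonneg hR hk hre, fun k hk =>
    ⟨Dunkl.isIntertwining_intertwiner hR hβ hk,
      fun V hV => hV.unique hk (Dunkl.isIntertwining_intertwiner hR hβ hk),
      Dunkl.exists_isCoeffBound hR hk, Dunkl.integralKernel R β k,
      Dunkl.memLp_integralKernel hR hβ hk, fun p x => ?_, fun L' hL' hrep x => ?_,
      fun x y => ?_, fun lam δ hlam x y => ?_⟩⟩
  · rw [Dunkl.expNegHalfLaplacian_toFun]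
    exact ⟨Dunkl.integrable_integralKernel_mul hR hβ hk x _,
      (Dunkl.integral_integralKernel hR hβ hk x p).symm⟩
  · refine Dunkl.integralKernel_unique hR hβ hk x (hL' x) fun p => ?_
    rw [hrep p x, Dunkl.expNegHalfLaplacian_toFun]
  · obtain ⟨lam, δ, hlam⟩ := Dunkl.exists_isCoeffBound hR hk
    exact (Dunkl.hasSum_integralKernel hR hβ hk hlam x y).2
  · refine (Dunkl.norm_integralKernel_le hR hβ hk hlam x y).trans ?_
    have h := Dunkl.sq_mul_norm_le (δ * Nat.card (Dunkl.reflGroup R)) x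
    have e : δ * Real.sqrt d * Nat.card (Dunkl.reflGroup R) * ‖x‖ =
        Real.sqrt d * (δ * Nat.card (Dunkl.reflGroup R) * ‖x‖) := by ring
    rw [e]
    gcongr
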